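/- A lattice polytope in $\mathbb{R}^n$ is the convex hull of a finite non-empty subset of $\mathbb{Z}^n$; its dimension is the dimension of its affine hull. For a lattice polytope $P$ and an integer $d \ge 0$ with $\dim P \le d$, the normalized volume $\operatorname{Vol}_d(P)$ is defined as follows: if $\dim P < d$, then $\operatorname{Vol}_d(P) = 0$; if $\dim P = d$ and $Y$ is the affine hull of $P$, choose an affine bijection $T \colon \mathbb{R}^d \to Y$ with $T(\mathbb{Z}^d) = Y \cap \mathbb{Z}^n$ and set $\operatorname{Vol}_d(P) = d! \cdot \operatorname{vol}_d(T^{-1}(P))$, where $\operatorname{vol}_d$ is Lebesgue measure on $\mathbb{R}^d$ (the value does not depend on $T$). A (non-empty) face of $P$ is a set of the form $\{x \in P : u^\top x = \max_{y \in P} u^\top y\}$ with $u \in \mathbb{R}^n$. **Proposition.** Let $p$ be a prime number, let $t \ge 1$ and $n$ be integers with $d = p^t \le n$, and let $A, B \subseteq \mathbb{R}^n$ be lattice polytopes of dimension at most $d$ such that $P = \operatorname{conv}(A \cup B)$ also has dimension at most $d$. If $\operatorname{Vol}_{p^{t-1}}(F)$ is an integer divisible by $p$ for every $p^{t-1}$-dimensional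 face $F$ of $A$ and every $p^{t-1}$-dimensional face $F$ of $B$, then $\operatorname{Vol}_{p^t}(P)$ is an integer divisible by $p$. -/

import Mathlib

/-- The points of `ℝⁿ` with integer coordinates, i.e. the lattice `ℤⁿ ⊆ ℝⁿ`. -/
def integerPoints (n : ℕ) : Set (Fin n → ℝ) :=
  {x | ∃ z : Fin n → ℤ, ∀ i, x i = (z i : ℝ)}

/-- A lattice polytope: the convex hull of a finite non-empty set of points of `ℤⁿ`. -/
def IsLatticePolytope {n : ℕ} (P : Set (Fin n → ℝ)) : Prop :=
  ∃ S : Set (Fin n → ℝ), S.Finite ∧ S.Nonempty ∧ S ⊆ integerPoints n ∧ P = convexHull ℝ S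

/-- The dimension of a non-empty convex set, i.e. the dimension of its affine hull. -/
noncomputable def polytopeDim {n : ℕ} (P : Set (Fin n → ℝ)) : ℕ :=
  Module.finrank ℝ (affineSpan ℝ P).direction

/-- The family of lattice polytopes in `ℝⁿ` of dimension at most `d`. -/
def latticePolytopes (n d : ℕ) : Set (Set (Fin n → ℝ)) :=
  {P | IsLatticePolytope P ∧ polytopeDim P ≤ d}

/-- `T` is an injective affine map `ℝᵈ → ℝⁿ` with image the affine subspace `Y`
that maps `ℤᵈ` onto `Y ∩ ℤⁿ`. -/
structure IsLatticeChart {n d : ℕ} (Y : AffineSubspace ℝ (Fin n → ℝ))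
    (T : (Fin d → ℝ) →ᵃ[ℝ] (Fin n → ℝ)) : Prop where
  injective : Function.Injective T
  range_eq : Set.range T = (Y : Set (Fin n → ℝ))
  image_integerPoints : T '' integerPoints d = (Y : Set (Fin n → ℝ)) ∩ integerPoints n

open Classical in
/-- The normalized `d`-dimensional volume of a polytope `P`: if `d = dim P`, it is
`d! · vol_d (T⁻¹ P)` for an affine bijection `T` of `ℝᵈ` onto the affine hull `Y` of `P` that
maps `ℤᵈ` onto `Y ∩ ℤⁿ`. Such a `T` exists for lattice polytopes, and the value does not
depend on it. If `dim P ≠ d`, then the value is `0`. -/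
noncomputable def normalizedVolume {n : ℕ} (d : ℕ) (P : Set (Fin n → ℝ)) : ℝ :=
  if h : polytopeDim P = d ∧
      ∃ T : (Fin d → ℝ) →ᵃ[ℝ] (Fin n → ℝ), IsLatticeChart (affineSpan ℝ P) T then
    (d.factorial : ℝ) * (MeasureTheory.volume (h.2.choose ⁻¹' P)).toReal
  else 0

/-- Lattice polytopes admit lattice charts of their affine hull. -/
theorem exists_isLatticeChart {n d : ℕ} {P : Set (Fin n → ℝ)} (hP : IsLatticePolytope P)
    (hd : polytopeDim P = d) :
    ∃ T : (Fin d → ℝ) →ᵃ[ℝ] (Fin n → ℝ), IsLatticeChart (affineSpan ℝ P) T := by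
  obtain ⟨S, -, ⟨q, hq⟩, hS, rfl⟩ := hP
  rw [affineSpan_convexHull]
  unfold polytopeDim at hd
  rw [affineSpan_convexHull] at hd
  set Y := affineSpan ℝ S with hY
  have hqY : q ∈ Y := subset_affineSpan ℝ S hq
  set L0 : Submodule ℤ (Fin n → ℝ) :=
    Submodule.span ℤ (Set.range (Pi.basisFun ℝ (Fin n))) with hL0
  have hmem0 : ∀ x, x ∈ L0 ↔ x ∈ integerPoints n := by
    intro x
    rw [hL0, Module.Basis.mem_span_iff_repr_mem]
    constructor
    · intro h
      choose z hz using h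
      exact ⟨z, fun i => by simpa using (hz i).symm⟩
    · rintro ⟨z, hz⟩ i
      exact ⟨z i, by simp [hz]⟩
  set L : Submodule ℤ Y.direction := L0.comap (Y.direction.subtype.restrictScalars ℤ) with hL
  have hmem : ∀ x : Y.direction, x ∈ L ↔ (x : Fin n → ℝ) ∈ integerPoints n := by
    intro x; rw [hL, Submodule.mem_comap, hmem0]; rfl
  have : DiscreteTopology L := by
    have hf : Continuous (fun x : L => (⟨((x : Y.direction) : Fin n → ℝ), x.2⟩ : L0)) := by
      fun_prop
    refine DiscreteTopology.of_continuous_injective hf ?_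
    intro x y h
    have h' : ((x : Y.direction) : Fin n → ℝ) = ((y : Y.direction) : Fin n → ℝ) :=
      congrArg (fun w : L0 => (w : Fin n → ℝ)) h
    exact Subtype.ext (Subtype.ext h')
  have : IsZLattice ℝ L := by
    refine ⟨?_⟩
    rw [eq_top_iff]
    have key : ∀ x ∈ Y.direction, ∀ hx : x ∈ Y.direction,
        (⟨x, hx⟩ : Y.direction) ∈ Submodule.span ℝ (L : Set Y.direction) := by
      intro x hx0
      rw [hY, direction_affineSpan, vectorSpan_eq_span_vsub_set_right ℝ hq] at hx0
      induction hx0 using Submodule.span_induction with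
      | mem x h =>
        intro hx
        obtain ⟨s, hs, rfl⟩ := h
        apply Submodule.subset_span
        rw [SetLike.mem_coe, hmem]
        exact (hmem0 _).1 (L0.sub_mem ((hmem0 _).2 (hS hs)) ((hmem0 _).2 (hS hq)))
      | zero => intro hx; exact Submodule.zero_mem _
      | add x y hx' hy' ihx ihy =>
        intro hx
        have e : Y.direction = Submodule.span ℝ ((· -ᵥ q) '' S) := by
          rw [hY, direction_affineSpan, vectorSpan_eq_span_vsub_set_right ℝ hq]
        exact Submodule.add_mem _ (ihx (e ▸ hx')) (ihy (e ▸ hy'))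
      | smul a x hx' ih =>
        intro hx
        have e : Y.direction = Submodule.span ℝ ((· -ᵥ q) '' S) := by
          rw [hY, direction_affineSpan, vectorSpan_eq_span_vsub_set_right ℝ hq]
        exact Submodule.smul_mem _ a (ih (e ▸ hx'))
    rintro ⟨x, hx⟩ -
    exact key x hx hx
  have hr : Module.finrank ℤ L = d := by rw [ZLattice.rank ℝ L, hd]
  let b := (Module.finBasisOfFinrankEq ℤ L hr).ofZLatticeBasis ℝ L
  have hbL : Submodule.span ℤ (Set.range b) = L := Module.Basis.ofZLatticeBasis_span ..
  have hint : ∀ x : Fin d → ℝ, ((b.equivFun.symm x : Y.direction) : Fin n → ℝ) ∈ integerPoints n ↔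
      x ∈ integerPoints d := by
    intro x
    rw [← hmem, ← hbL, Module.Basis.mem_span_iff_repr_mem]
    have : ∀ i, b.repr (b.equivFun.symm x) i = x i := fun i => by
      rw [← Module.Basis.equivFun_apply, LinearEquiv.apply_symm_apply]
    simp only [this]
    constructor
    · intro h
      choose z hz using h
      exact ⟨z, fun i => by simpa using (hz i).symm⟩
    · rintro ⟨z, hz⟩ i
      exact ⟨z i, by simp [hz]⟩
  let T : (Fin d → ℝ) →ᵃ[ℝ] (Fin n → ℝ) :=
    (Y.direction.subtype ∘ₗ b.equivFun.symm.toLinearMap).toAffineMap +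
      AffineMap.const ℝ (Fin d → ℝ) q
  have hT : ∀ x, T x = ((b.equivFun.symm x : Y.direction) : Fin n → ℝ) + q := fun x => rfl
  have hrange : ∀ y, y ∈ Y → ∃ x, T x = y := by
    intro y hy
    refine ⟨b.equivFun ⟨y -ᵥ q, Y.vsub_mem_direction hy hqY⟩, ?_⟩
    rw [hT, LinearEquiv.symm_apply_apply]
    simp
  have hTY : ∀ x, T x ∈ Y := fun x =>
    Y.vadd_mem_of_mem_direction (b.equivFun.symm x).2 hqY
  have hTint : ∀ x, T x ∈ integerPoints n ↔ x ∈ integerPoints d := by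
    intro x
    rw [← hint, ← hmem0, ← hmem0, hT]
    exact L0.add_mem_iff_left ((hmem0 _).2 (hS hq))
  refine ⟨T, ?_, ?_, ?_⟩
  · intro x y h
    rw [hT, hT, add_left_inj] at h
    exact b.equivFun.symm.injective (Subtype.ext h)
  · ext y
    exact ⟨by rintro ⟨x, rfl⟩; exact hTY x, fun hy => hrange y hy⟩
  · ext y
    constructor
    · rintro ⟨x, hx, rfl⟩
      exact ⟨hTY x, (hTint x).2 hx⟩
    · rintro ⟨hy, hyi⟩
      obtain ⟨x, rfl⟩ := hrange y hy
      exact ⟨x, (hTint x).1 hyi, rfl⟩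

theorem IsLatticeChart.volume_preimage_eq {n d : ℕ} {Y : AffineSubspace ℝ (Fin n → ℝ)}
    {T T' : (Fin d → ℝ) →ᵃ[ℝ] (Fin n → ℝ)} (hT : IsLatticeChart Y T) (hT' : IsLatticeChart Y T')
    (P : Set (Fin n → ℝ)) :
    MeasureTheory.volume (T ⁻¹' P) = MeasureTheory.volume (T' ⁻¹' P) := by
  have aux : ∀ {T T' : (Fin d → ℝ) →ᵃ[ℝ] (Fin n → ℝ)}, IsLatticeChart Y T → IsLatticeChart Y T' →
      ∃ (M : Matrix (Fin d) (Fin d) ℤ) (c : Fin d → ℝ), ∀ x,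
        T x = T' ((M.map (Int.castRingHom ℝ)).mulVec x + c) := by
    intro T T' hT hT'
    have hex : ∀ x, ∃ y, T' y = T x := fun x => by
      have : T x ∈ Set.range T' := by rw [hT'.range_eq, ← hT.range_eq]; exact ⟨x, rfl⟩
      exact this
    have hexi : ∀ x ∈ integerPoints d, ∃ y ∈ integerPoints d, T' y = T x := fun x hx => by
      have : T x ∈ T' '' integerPoints d := by
        rw [hT'.image_integerPoints, ← hT.image_integerPoints]; exact ⟨x, hx, rfl⟩
      exact this
    have h0 : (0 : Fin d → ℝ) ∈ integerPoints d := ⟨0, by simp⟩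
    have h1 : ∀ j, (Pi.single j 1 : Fin d → ℝ) ∈ integerPoints d := fun j =>
      ⟨Pi.single j 1, fun i => by by_cases h : i = j <;> simp [h]⟩
    obtain ⟨c, ⟨cz, hcz⟩, hc⟩ := hexi 0 h0
    choose v hvz hv using fun j => hexi _ (h1 j)
    choose vz hvz using hvz
    refine ⟨Matrix.of fun i j => vz j i - cz i, c, fun x => ?_⟩
    have e1 : ∀ j, T'.linear (v j - c) = T.linear (Pi.single j 1) := by
      intro j
      have := T'.linearMap_vsub (v j) c
      rw [vsub_eq_sub] at this
      rw [this, hv, hc, ← T.linearMap_vsub]; simp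
    have e2 : (Matrix.map (Matrix.of fun i j => vz j i - cz i) (Int.castRingHom ℝ)).mulVec x
        = ∑ j, x j • (v j - c) := by
      ext i
      simp [Matrix.mulVec, dotProduct, hvz, hcz, mul_comm]
    have e3 : T x = T.linear x + T 0 := by
      have := T.linearMap_vsub x 0
      simp only [vsub_eq_sub, sub_zero] at this
      rw [this]; abel
    have e4 : ∀ w, T' (w + c) = T'.linear w + T' c := fun w => T'.map_vadd c w
    rw [e4, e2, e3, hc, map_sum]
    congr 1
    conv_lhs => rw [pi_eq_sum_univ' x]
    simp [e1]
  obtain ⟨M, c, hM⟩ := aux hT hT'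
  obtain ⟨N, e, hN⟩ := aux hT' hT
  have hid : ∀ x, (N.map (Int.castRingHom ℝ)).mulVec ((M.map (Int.castRingHom ℝ)).mulVec x + c) + e
      = x := fun x => hT.injective (by rw [← hN, ← hM])
  have hNM : N * M = 1 := by
    have h0 := hid 0
    rw [Matrix.mulVec_zero, zero_add] at h0
    have h2 : (N * M).map (Int.castRingHom ℝ) = (1 : Matrix (Fin d) (Fin d) ℝ) := by
      apply Matrix.ext_of_mulVec_single
      intro j
      have h3 := hid (Pi.single j 1)
      rw [Matrix.mulVec_add, add_assoc, h0, add_zero, Matrix.mulVec_mulVec] at h3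
      rw [Matrix.map_mul, h3, Matrix.one_mulVec]
    have h4 : (N * M).map (Int.castRingHom ℝ)
        = (1 : Matrix (Fin d) (Fin d) ℤ).map (Int.castRingHom ℝ) := by
      rw [h2, Matrix.map_one _ (map_zero _) (map_one _)]
    exact Matrix.map_injective Int.cast_injective h4
  have hdet : |(M.map (Int.castRingHom ℝ)).det| = 1 := by
    have hu : IsUnit M.det := by
      refine IsUnit.of_mul_eq_one N.det ?_
      rw [mul_comm, ← Matrix.det_mul, hNM, Matrix.det_one]
    have h5 : (M.map (Int.castRingHom ℝ)).det = ((M.det : ℤ) : ℝ) :=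
      ((Int.castRingHom ℝ).map_det M).symm
    rw [h5, ← Int.cast_abs, Int.isUnit_iff_abs_eq.1 hu, Int.cast_one]
  have hset : T ⁻¹' P = Matrix.toLin' (M.map (Int.castRingHom ℝ)) ⁻¹'
      ((fun y => y + c) ⁻¹' (T' ⁻¹' P)) := by
    ext x
    simp only [Set.mem_preimage, hM x, Matrix.toLin'_apply]
  have hdet' : LinearMap.det (Matrix.toLin' (M.map (Int.castRingHom ℝ))) ≠ 0 := by
    rw [LinearMap.det_toLin']
    intro h
    rw [h] at hdet
    simp at hdet
  rw [hset, MeasureTheory.Measure.addHaar_preimage_linearMap _ hdet', LinearMap.det_toLin',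
    abs_inv, hdet, MeasureTheory.measure_preimage_add_right]
  simp

/-- The normalized volume does not depend on the choice of the affine bijection. -/
theorem normalizedVolume_eq {n d : ℕ} {P : Set (Fin n → ℝ)} (hd : polytopeDim P = d)
    {T : (Fin d → ℝ) →ᵃ[ℝ] (Fin n → ℝ)} (hT : IsLatticeChart (affineSpan ℝ P) T) :
    normalizedVolume d P = (d.factorial : ℝ) * (MeasureTheory.volume (T ⁻¹' P)).toReal := by
  have h : polytopeDim P = d ∧
      ∃ T : (Fin d → ℝ) →ᵃ[ℝ] (Fin n → ℝ), IsLatticeChart (affineSpan ℝ P) T := ⟨hd, T, hT⟩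
  rw [normalizedVolume, dif_pos h, h.2.choose_spec.volume_preimage_eq hT]

/-! Write A = conv S and B = conv S'. Give the points of S height 0 and each x in S' height ψ(x, 1),
where ψ is a linear functional on ℝⁿ × ℝ in general position, and take the regular subdivision of P
induced by these heights. A full-dimensional cell is spanned by the points where an affine f below
the heights touches them, so it is the hull of a face F of A and a face G of B, one of them possibly
empty. The linear extension of f vanishes on the span of F × {1} and equals ψ on the span of G ×
{1}. General position therefore forces these spans to meet only in 0: if F and G are non-empty, the
cell is their join and dim F + dim G + 1 = p^t (`normalizedVolume_mem_of_mixed_cells`).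

The normalized volume of a join is an integer times the product of those of F and G
(`exists_normalizedVolume_join`): integrating over the slices (1 - s)F × sG gives i! j! / (i + j +
1)!, which the normalization absorbs, and what remains is the determinant of an integral matrix.

As p^t ≥ 2 p^(t-1), one of F, G has dimension at least p^(t-1). Divisibility by p climbs from the
faces of dimension p^(t-1) to all larger ones, since a polytope is cut into pyramids over facets and
a pyramid has volume an integer multiple of that of its base (`normalizedVolume_mem_of_facets`, the
case where S' is a single point of S). The same induction from points shows that normalized volumes
are integers, so every cell contributes a multiple of p. -/

/-! ### Convex combinations and affine maps -/

theorem convexHull_range_eq_image_stdSimplex {ι E : Type*} [Fintype ι] [AddCommGroup E]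
    [Module ℝ E] (a : ι → E) :
    convexHull ℝ (Set.range a) = (fun w : ι → ℝ => ∑ i, w i • a i) '' stdSimplex ℝ ι := by
  classical
  rw [← convexHull_basis_eq_stdSimplex]
  have h := (Fintype.linearCombination ℝ a).image_convexHull
    (Set.range fun i j : ι => if i = j then (1 : ℝ) else 0)
  have e : ⇑(Fintype.linearCombination ℝ a) = fun w : ι → ℝ => ∑ i, w i • a i := by
    ext w; simp [Fintype.linearCombination_apply]
  rw [e] at h
  rw [h, ← Set.range_comp]
  congr 2
  ext i
  simp

theorem AffineMap.map_sum_of_sum_eq_one {ι E F : Type*} [Fintype ι] [AddCommGroup E]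
    [Module ℝ E] [AddCommGroup F] [Module ℝ F] (f : E →ᵃ[ℝ] F) (a : ι → E) {w : ι → ℝ}
    (hw : ∑ i, w i = 1) : f (∑ i, w i • a i) = ∑ i, w i • f (a i) := by
  have h := Finset.univ.map_affineCombination a w hw f
  rw [Finset.affineCombination_eq_linear_combination _ _ _ hw,
    Finset.affineCombination_eq_linear_combination _ _ _ hw] at h
  exact h

theorem AffineMap.le_of_mem_convexHull {E : Type*} [AddCommGroup E]
    [Module ℝ E] (f g : E →ᵃ[ℝ] ℝ) {s : Set E} (h : ∀ x ∈ s, f x ≤ g x) {x : E}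
    (hx : x ∈ convexHull ℝ s) : f x ≤ g x := by
  have hc : Convex ℝ {x | (f - g) x ≤ 0} := (convex_Iic (0 : ℝ)).affine_preimage (f - g)
  have := convexHull_min (t := {x | (f - g) x ≤ 0}) (fun y hy => by simpa using h y hy) hc hx
  simpa using this

theorem sum_smul_mem_convexHull {ι E : Type*} [Fintype ι] [AddCommGroup E] [Module ℝ E]
    {s : Set E} {w : ι → ℝ} {z : ι → E} (hw : ∀ i, 0 ≤ w i) (hw1 : ∑ i, w i = 1)
    (hz : ∀ i, w i ≠ 0 → z i ∈ s) : ∑ i, w i • z i ∈ convexHull ℝ s := by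
  classical
  rw [← Finset.sum_filter_of_ne (p := fun i => w i ≠ 0) (fun i _ h h0 => h (by simp [h0]))]
  refine (convex_convexHull ℝ _).sum_mem (fun i _ => hw i) ?_
    fun i hi => subset_convexHull ℝ _ (hz i (by simpa using hi))
  rw [Finset.sum_filter_ne_zero]
  exact hw1

/-! ### Regular subdivisions -/

/-- Every interior point of the convex hull of a finite family of points with heights lies in the
convex hull of the contact points of some affine function below the heights. -/
theorem exists_affine_le_of_mem_interior_convexHull {ι E : Type*} [Fintype ι]
    [NormedAddCommGroup E] [NormedSpace ℝ E] [FiniteDimensional ℝ E]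
    (a : ι → E) (ω : ι → ℝ) {x : E} (hx : x ∈ interior (convexHull ℝ (Set.range a))) :
    ∃ f : E →ᵃ[ℝ] ℝ, (∀ i, f (a i) ≤ ω i) ∧
      x ∈ convexHull ℝ (a '' {i | f (a i) = ω i}) := by
  set K := convexHull ℝ (Set.range a) with hK
  have hKeq := convexHull_range_eq_image_stdSimplex a
  -- a representation of `x` of minimal height
  obtain ⟨w, ⟨hw, hwx⟩, hmin⟩ : ∃ w ∈ {w | w ∈ stdSimplex ℝ ι ∧ ∑ i, w i • a i = x},
      IsMinOn (fun w : ι → ℝ => ∑ i, w i * ω i)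
        {w | w ∈ stdSimplex ℝ ι ∧ ∑ i, w i • a i = x} w := by
    refine IsCompact.exists_isMinOn ?_ ?_ (by fun_prop)
    · exact (isCompact_stdSimplex ℝ ι).inter_right
        (isClosed_singleton.preimage (f := fun w : ι → ℝ => ∑ i, w i • a i) (by fun_prop))
    · have := interior_subset hx
      rw [hK, hKeq] at this
      obtain ⟨w, hw, h⟩ := this
      exact ⟨w, hw, h⟩
  set r := ∑ i, w i * ω i with hr
  -- The epigraph of the minimal height. Minimality of `r` keeps `(x, r)` out of its interior, and a
  -- supporting hyperplane there will be the graph of `f`.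
  let Q : Set (E × ℝ) := {z | ∃ v ∈ stdSimplex ℝ ι, ∑ i, v i • a i = z.1 ∧ ∑ i, v i * ω i ≤ z.2}
  have hQ : Convex ℝ Q := by
    rintro z ⟨v, hv, hv1, hv2⟩ z' ⟨v', hv', hv1', hv2'⟩ s t hs ht hst
    refine ⟨s • v + t • v', convex_stdSimplex ℝ ι hv hv' hs ht hst, ?_, ?_⟩
    · simp [add_smul, Finset.sum_add_distrib, mul_smul, ← Finset.smul_sum, hv1, hv1']
    · simp only [Pi.add_apply, Pi.smul_apply, smul_eq_mul, add_mul, mul_assoc,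
        Finset.sum_add_distrib, ← Finset.mul_sum, Prod.snd_add, Prod.smul_snd]
      gcongr
  have hxr : (x, r) ∉ interior Q := by
    intro h
    have hc : Continuous fun ε : ℝ => (x, r - ε) := by fun_prop
    have h0 : (fun ε : ℝ => (x, r - ε)) ⁻¹' Q ∈ nhds (0 : ℝ) :=
      hc.continuousAt (by simpa using mem_interior_iff_mem_nhds.1 h)
    obtain ⟨δ, hδ, hball⟩ := Metric.mem_nhds_iff.1 h0
    obtain ⟨v, hv, hv1, hv2⟩ := hball (show δ / 2 ∈ Metric.ball (0 : ℝ) δ by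
      rw [mem_ball_zero_iff, Real.norm_of_nonneg (by positivity)]; linarith)
    have := hmin (show v ∈ {w | w ∈ stdSimplex ℝ ι ∧ ∑ i, w i • a i = x} from ⟨hv, hv1⟩)
    simp only [Set.mem_ofPred_eq] at this hv2
    linarith
  have hint : (interior Q).Nonempty := by
    obtain ⟨R, hR⟩ : ∃ R : ℝ, ∀ i, ω i ≤ R := by
      obtain ⟨R, hR⟩ := (Set.finite_range ω).bddAbove
      exact ⟨R, fun i => hR ⟨i, rfl⟩⟩
    refine ⟨(x, R + 1), ?_⟩
    have hop : IsOpen (interior K ×ˢ Set.Ioi R) := isOpen_interior.prod isOpen_Ioi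
    refine interior_maximal ?_ hop ⟨hx, by simp⟩
    rintro ⟨y, s⟩ ⟨hy, hs⟩
    have := interior_subset hy
    rw [hK, hKeq] at this
    obtain ⟨v, hv, h⟩ := this
    refine ⟨v, hv, h, ?_⟩
    calc ∑ i, v i * ω i ≤ ∑ i, v i * R :=
          Finset.sum_le_sum fun i _ => mul_le_mul_of_nonneg_left (hR i) (hv.1 i)
      _ = R := by rw [← Finset.sum_mul, hv.2, one_mul]
      _ ≤ s := le_of_lt hs
  obtain ⟨φ, u, hφ0, hφQ, hφx⟩ := geometric_hahn_banach_of_nonempty_interior hQ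
    (convex_singleton (x, r)) (by simpa using hxr) hint (Set.singleton_nonempty _)
  have hφle : ∀ z ∈ Q, φ z ≤ φ (x, r) := fun z hz => (hφQ z hz).trans (hφx _ rfl)
  have hsplit : ∀ y s, φ (y, s) = φ (y, 0) + s * φ (0, 1) := by
    intro y s
    have : (y, s) = (y, (0 : ℝ)) + s • ((0 : E), (1 : ℝ)) := by simp
    rw [this, map_add, map_smul, smul_eq_mul]
  have hc0 : φ (0, 1) ≤ 0 := by
    have := hφle (x, r + 1) ⟨w, hw, hwx, by simp [hr]⟩
    rw [hsplit, hsplit x r] at this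
    linarith
  -- The hyperplane is not vertical: otherwise `φ (·, 0)` would have a local maximum at the interior
  -- point `x`, hence vanish, and so would `φ`.
  have hc : φ (0, 1) < 0 := by
    refine lt_of_le_of_ne hc0 fun h0 => hφ0 ?_
    have hloc : IsLocalMax (fun y : E => φ (y, 0)) x := by
      filter_upwards [mem_interior_iff_mem_nhds.1 hx] with y hy
      rw [hK, hKeq] at hy
      obtain ⟨v, hv, h⟩ := hy
      have := hφle (y, ∑ i, v i * ω i) ⟨v, hv, h, le_rfl⟩
      rw [hsplit, hsplit x r, h0] at this
      simpa using this
    have hd : HasFDerivAt (fun y : E => φ (y, 0)) (φ.comp (ContinuousLinearMap.inl ℝ E ℝ)) x :=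
      (φ.comp (ContinuousLinearMap.inl ℝ E ℝ)).hasFDerivAt
    have hz := hloc.hasFDerivAt_eq_zero hd
    refine ContinuousLinearMap.ext fun ⟨y, s⟩ => ?_
    have hy : φ (y, 0) = 0 := by simpa using congrArg (fun g : E →L[ℝ] ℝ => g y) hz
    rw [hsplit, h0, hy]; simp
  set c := φ (0, 1) with hcdef
  -- `f` is the equation `φ (y, f y) = φ (x, r)` solved for the last coordinate.
  let lin : E →ₗ[ℝ] ℝ := (-c⁻¹) • (φ.comp (ContinuousLinearMap.inl ℝ E ℝ)).toLinearMap
  let f : E →ᵃ[ℝ] ℝ := lin.toAffineMap + AffineMap.const ℝ E (c⁻¹ * φ (x, r))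
  have hf : ∀ y, f y = -c⁻¹ * φ (y, 0) + c⁻¹ * φ (x, r) := fun y => by
    simp [f, lin]
  have hfle : ∀ i, f (a i) ≤ ω i := by
    intro i
    classical
    have := hφle (a i, ω i) ⟨Pi.single i 1, single_mem_stdSimplex ℝ i, by
      simp [Pi.single_apply], by simp [Pi.single_apply]⟩
    rw [hsplit] at this
    rw [hf]
    have h2 : c * ω i ≤ φ (x, r) - φ (a i, 0) := by linarith
    have h3 : c⁻¹ * (φ (x, r) - φ (a i, 0)) ≤ c⁻¹ * (c * ω i) :=
      mul_le_mul_of_nonpos_left h2 (inv_nonpos.2 hc0)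
    rw [inv_mul_cancel_left₀ hc.ne] at h3
    linarith
  have hfx : f x = r := by
    rw [hf, hsplit x r]
    have := inv_mul_cancel_left₀ hc.ne r
    linear_combination this
  refine ⟨f, hfle, ?_⟩
  -- Complementary slackness: the sum is `r - f x = 0` and its terms are nonnegative, so `w` is
  -- supported on the contact points.
  have hsum : ∑ i, w i * (ω i - f (a i)) = 0 := by
    simp only [mul_sub, Finset.sum_sub_distrib]
    rw [← hr, ← hfx, ← hwx, f.map_sum_of_sum_eq_one a hw.2]
    simp
  have hzero := (Finset.sum_eq_zero_iff_of_nonneg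
    (fun i _ => mul_nonneg (hw.1 i) (sub_nonneg.2 (hfle i)))).1 hsum
  rw [← hwx]
  refine sum_smul_mem_convexHull hw.1 hw.2 fun i hi => ⟨i, ?_, rfl⟩
  have := (mul_eq_zero.1 (hzero i (Finset.mem_univ i))).resolve_left hi
  simp only [Set.mem_ofPred_eq]; linarith

open MeasureTheory in
/-- The regular subdivision of a finite family of points induced by heights: the measure of the convex
hull is the sum of the measures of the full-dimensional cells. -/
theorem exists_regular_subdivision {ι E : Type*} [Fintype ι]
    [NormedAddCommGroup E] [NormedSpace ℝ E] [FiniteDimensional ℝ E] [MeasurableSpace E]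
    [BorelSpace E] (μ : Measure E) [μ.IsAddHaarMeasure] (a : ι → E) (ω : ι → ℝ) :
    ∃ C : Finset (Set ι), (∀ I ∈ C, affineSpan ℝ (a '' I) = ⊤ ∧
        ∃ f : E →ᵃ[ℝ] ℝ, (∀ i, f (a i) ≤ ω i) ∧ I = {i | f (a i) = ω i}) ∧
      μ (convexHull ℝ (Set.range a)) = ∑ I ∈ C, μ (convexHull ℝ (a '' I)) := by
  classical
  let p : Set ι → Prop := fun I =>
    ∃ f : E →ᵃ[ℝ] ℝ, (∀ i, f (a i) ≤ ω i) ∧ I = {i | f (a i) = ω i}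
  let C : Finset (Set ι) := Finset.univ.filter fun I => affineSpan ℝ (a '' I) = ⊤ ∧ p I
  have hnull : ∀ I, affineSpan ℝ (a '' I) ≠ ⊤ → μ (convexHull ℝ (a '' I)) = 0 := fun I hI =>
    measure_mono_null (convexHull_subset_affineSpan _) (Measure.addHaar_affineSubspace μ _ hI)
  refine ⟨C, fun I hI => by simpa [C, p] using hI, ?_⟩
  rw [← measure_biUnion_finset₀]
  · refine le_antisymm ?_ (measure_mono (Set.iUnion₂_subset fun I _ =>
      convexHull_mono (Set.image_subset_range _ _)))
    -- What the full-dimensional cells miss lies on the frontier or in one of finitely many cells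
    -- inside proper affine subspaces, hence is null.
    have hcov : convexHull ℝ (Set.range a) ⊆ (⋃ I ∈ C, convexHull ℝ (a '' I)) ∪
        (frontier (convexHull ℝ (Set.range a)) ∪
          ⋃ I ∈ {I : Set ι | affineSpan ℝ (a '' I) ≠ ⊤}, convexHull ℝ (a '' I)) := by
      intro x hx
      by_cases hxi : x ∈ interior (convexHull ℝ (Set.range a))
      · obtain ⟨f, hf, hxf⟩ := exists_affine_le_of_mem_interior_convexHull a ω hxi
        by_cases hsp : affineSpan ℝ (a '' {i | f (a i) = ω i}) = ⊤
        · exact Or.inl (Set.mem_biUnion (x := {i | f (a i) = ω i})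
            (by simpa [C, p] using ⟨hsp, f, hf, rfl⟩) hxf)
        · exact Or.inr (Or.inr (Set.mem_biUnion (x := {i | f (a i) = ω i}) hsp hxf))
      · exact Or.inr (Or.inl ⟨subset_closure hx, hxi⟩)
    have h0 : μ (frontier (convexHull ℝ (Set.range a)) ∪
          ⋃ I ∈ {I : Set ι | affineSpan ℝ (a '' I) ≠ ⊤}, convexHull ℝ (a '' I)) = 0 := by
      refine measure_union_null ((convex_convexHull ℝ _).addHaar_frontier μ) ?_
      exact (measure_biUnion_null_iff (Set.to_countable _)).2 fun I hI => hnull I hI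
    calc μ _ ≤ _ := measure_mono hcov
      _ ≤ _ := measure_union_le _ _
      _ = _ := by rw [h0, add_zero]
  · intro I hI J hJ hIJ
    simp only [C, Finset.coe_filter, Finset.mem_univ, true_and, Set.mem_ofPred_eq] at hI hJ
    obtain ⟨-, f, hf, rfl⟩ := hI
    obtain ⟨-, g, hg, rfl⟩ := hJ
    -- On the cell of `f` one has `g ≤ f`, and conversely on the cell of `g`; so two distinct cells
    -- overlap inside the proper affine subspace `f = g`.
    have hfg : (AffineSubspace.mk' (0 : ℝ) (⊥ : Submodule ℝ ℝ)).comap (f - g) ≠ ⊤ := by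
      intro h
      apply hIJ
      have : f = g := by
        ext x
        have hx : x ∈ (AffineSubspace.mk' (0 : ℝ) (⊥ : Submodule ℝ ℝ)).comap (f - g) := by
          rw [h]; trivial
        simpa [AffineSubspace.mem_comap, sub_eq_zero] using hx
      rw [this]
    refine measure_mono_null ?_ (Measure.addHaar_affineSubspace μ _ hfg)
    rintro x ⟨hx1, hx2⟩
    have h1 : g x ≤ f x := g.le_of_mem_convexHull f (by
      rintro _ ⟨i, hi, rfl⟩
      exact (hg i).trans (le_of_eq (Eq.symm hi))) hx1
    have h2 : f x ≤ g x := f.le_of_mem_convexHull g (by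
      rintro _ ⟨i, hi, rfl⟩
      exact (hf i).trans (le_of_eq (Eq.symm hi))) hx2
    simp [le_antisymm h2 h1]
  · intro I _
    exact ((Set.toFinite _).isCompact_convexHull ℝ).measurableSet.nullMeasurableSet

/-! ### Volume of a join -/

open MeasureTheory in
-- This is the beta function at (j + 1, i + 1), read off from the total mass 1 of the beta density.
-- It integrates the scaling factors of the slices (1 - s)F × sG, where i and j are the dimensions
-- of the ambient spaces of F and G.
theorem lintegral_one_sub_pow_mul_pow (i j : ℕ) :
    ∫⁻ s in Set.Ioo (0 : ℝ) 1, ENNReal.ofReal ((1 - s) ^ i) * ENNReal.ofReal (s ^ j) =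
      ENNReal.ofReal (i.factorial * j.factorial / (i + j + 1).factorial) := by
  have hj : (0 : ℝ) < j + 1 := by positivity
  have hi : (0 : ℝ) < i + 1 := by positivity
  have hb : ProbabilityTheory.beta (j + 1) (i + 1) =
      i.factorial * j.factorial / (i + j + 1).factorial := by
    rw [ProbabilityTheory.beta, Real.Gamma_nat_eq_factorial, Real.Gamma_nat_eq_factorial]
    have : ((j : ℝ) + 1 + (i + 1)) = ((i + j + 1 : ℕ) : ℝ) + 1 := by push_cast; ring
    rw [this, Real.Gamma_nat_eq_factorial, mul_comm]
  have hbpos := ProbabilityTheory.beta_pos hj hi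
  have h1 := ProbabilityTheory.lintegral_betaPDF_eq_one hj hi
  rw [ProbabilityTheory.lintegral_betaPDF] at h1
  rw [← hb]
  have h2 : ∫⁻ s in Set.Ioo (0 : ℝ) 1, ENNReal.ofReal ((1 - s) ^ i) * ENNReal.ofReal (s ^ j) =
      ∫⁻ s in Set.Ioo (0 : ℝ) 1, ENNReal.ofReal (ProbabilityTheory.beta (j + 1) (i + 1)) *
        ENNReal.ofReal (1 / ProbabilityTheory.beta (j + 1) (i + 1) *
          s ^ ((j : ℝ) + 1 - 1) * (1 - s) ^ ((i : ℝ) + 1 - 1)) := by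
    refine setLIntegral_congr_fun measurableSet_Ioo fun s hs => ?_
    have : (0 : ℝ) ≤ 1 - s := by linarith [hs.2]
    rw [← ENNReal.ofReal_mul (by positivity), ← ENNReal.ofReal_mul hbpos.le]
    congr 1
    simp only [add_sub_cancel_right, Real.rpow_natCast]
    field_simp
  rw [h2, lintegral_const_mul _ (by fun_prop), h1, mul_one]

open MeasureTheory in
/-- The volume of the region above which the slices are `(1 - s) • F × s • G`. -/
theorem measure_join_slices {X Y : Type*} [NormedAddCommGroup X] [NormedSpace ℝ X]
    [FiniteDimensional ℝ X] [MeasurableSpace X] [BorelSpace X]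
    [NormedAddCommGroup Y] [NormedSpace ℝ Y]
    [FiniteDimensional ℝ Y] [MeasurableSpace Y] [BorelSpace Y]
    (μ : Measure X) [μ.IsAddHaarMeasure] (ν : Measure Y) [ν.IsAddHaarMeasure]
    {F : Set X} {G : Set Y} (hF : MeasurableSet F) (hG : MeasurableSet G) :
    MeasurableSet {z : ℝ × X × Y | z.1 ∈ Set.Ioo (0 : ℝ) 1 ∧ (1 - z.1)⁻¹ • z.2.1 ∈ F ∧
      z.1⁻¹ • z.2.2 ∈ G} ∧
    (volume.prod (μ.prod ν)) {z : ℝ × X × Y | z.1 ∈ Set.Ioo (0 : ℝ) 1 ∧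
        (1 - z.1)⁻¹ • z.2.1 ∈ F ∧ z.1⁻¹ • z.2.2 ∈ G} =
      ENNReal.ofReal ((Module.finrank ℝ X).factorial * (Module.finrank ℝ Y).factorial /
        (Module.finrank ℝ X + Module.finrank ℝ Y + 1).factorial) * (μ F * ν G) := by
  have hm : MeasurableSet {z : ℝ × X × Y | z.1 ∈ Set.Ioo (0 : ℝ) 1 ∧ (1 - z.1)⁻¹ • z.2.1 ∈ F ∧
      z.1⁻¹ • z.2.2 ∈ G} := by
    refine (measurable_fst measurableSet_Ioo).inter (MeasurableSet.inter ?_ ?_)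
    · exact (show Measurable fun z : ℝ × X × Y => (1 - z.1)⁻¹ • z.2.1 by fun_prop) hF
    · exact (show Measurable fun z : ℝ × X × Y => z.1⁻¹ • z.2.2 by fun_prop) hG
  refine ⟨hm, ?_⟩
  rw [Measure.prod_apply hm, ← lintegral_one_sub_pow_mul_pow,
    ← lintegral_mul_const _ (by fun_prop), ← lintegral_indicator measurableSet_Ioo]
  congr 1 with s
  by_cases hs : s ∈ Set.Ioo (0 : ℝ) 1
  · have h1 : (0 : ℝ) < 1 - s := by linarith [hs.2]
    have hset : Prod.mk s ⁻¹' {z : ℝ × X × Y | z.1 ∈ Set.Ioo (0 : ℝ) 1 ∧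
        (1 - z.1)⁻¹ • z.2.1 ∈ F ∧ z.1⁻¹ • z.2.2 ∈ G} =
        ((fun x => (1 - s)⁻¹ • x) ⁻¹' F) ×ˢ ((fun y => s⁻¹ • y) ⁻¹' G) := by
      ext ⟨x, y⟩
      simp [hs.1, hs.2]
    rw [hset, Set.indicator_of_mem hs, Measure.prod_prod,
      Measure.addHaar_preimage_smul μ (inv_ne_zero h1.ne'),
      Measure.addHaar_preimage_smul ν (inv_ne_zero hs.1.ne')]
    simp only [inv_pow, inv_inv, abs_of_nonneg (pow_nonneg h1.le _),
      abs_of_nonneg (pow_nonneg hs.1.le _)]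
    ring
  · have hset : Prod.mk s ⁻¹' {z : ℝ × X × Y | z.1 ∈ Set.Ioo (0 : ℝ) 1 ∧
        (1 - z.1)⁻¹ • z.2.1 ∈ F ∧ z.1⁻¹ • z.2.2 ∈ G} = ∅ := by
      ext z
      simp only [Set.mem_preimage, Set.mem_ofPred_eq, Set.mem_empty_iff_false, iff_false]
      exact fun h => hs h.1
    rw [hset, Set.indicator_of_notMem hs, measure_empty]

open MeasureTheory in
/-- A linear identification of `ℝ^(i+j+1)` with `ℝ × ℝⁱ × ℝʲ` that preserves volume and
integrality. -/
theorem exists_measurePreserving_linearMap_prod (i j : ℕ) :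
    ∃ e : (Fin (i + j + 1) → ℝ) →ₗ[ℝ] ℝ × (Fin i → ℝ) × (Fin j → ℝ),
      Function.Surjective e ∧ MeasurePreserving e volume volume ∧
      ∀ x ∈ integerPoints (i + j + 1), (∃ z : ℤ, (e x).1 = z) ∧
        (e x).2.1 ∈ integerPoints i ∧ (e x).2.2 ∈ integerPoints j := by
  have hcard : Fintype.card (Unit ⊕ (Fin i ⊕ Fin j)) = Fintype.card (Fin (i + j + 1)) := by
    simp; ring
  let ε : Unit ⊕ (Fin i ⊕ Fin j) ≃ Fin (i + j + 1) := Fintype.equivOfCardEq hcard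
  let e : (Fin (i + j + 1) → ℝ) →ₗ[ℝ] ℝ × (Fin i → ℝ) × (Fin j → ℝ) :=
    { toFun := fun x => (x (ε (Sum.inl ())), fun k => x (ε (Sum.inr (Sum.inl k))),
        fun k => x (ε (Sum.inr (Sum.inr k))))
      map_add' := fun _ _ => rfl
      map_smul' := fun _ _ => rfl }
  refine ⟨e, ?_, ?_, ?_⟩
  · rintro ⟨s, f, g⟩
    refine ⟨fun l => Sum.elim (fun _ => s) (Sum.elim f g) (ε.symm l), ?_⟩
    simp [e]
  · have h1 := (volume_measurePreserving_piCongrLeft (fun _ : Fin (i + j + 1) => ℝ) ε).symm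
    have h2 := volume_measurePreserving_sumPiEquivProdPi (fun _ : Unit ⊕ (Fin i ⊕ Fin j) => ℝ)
    have h3 := volume_measurePreserving_sumPiEquivProdPi (fun _ : Fin i ⊕ Fin j => ℝ)
    have h4 := volume_preserving_funUnique Unit ℝ
    exact ((h4.prod h3).comp h2).comp h1
  · rintro x ⟨z, hz⟩
    exact ⟨⟨_, hz _⟩, ⟨fun k => z _, fun k => hz _⟩, ⟨fun k => z _, fun k => hz _⟩⟩

theorem integerPoints_sub {n : ℕ} {x y : Fin n → ℝ} (hx : x ∈ integerPoints n)
    (hy : y ∈ integerPoints n) : x - y ∈ integerPoints n := by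
  obtain ⟨z, hz⟩ := hx
  obtain ⟨w, hw⟩ := hy
  exact ⟨z - w, fun i => by simp [hz, hw]⟩

theorem integerPoints_add {n : ℕ} {x y : Fin n → ℝ} (hx : x ∈ integerPoints n)
    (hy : y ∈ integerPoints n) : x + y ∈ integerPoints n := by
  obtain ⟨z, hz⟩ := hx
  obtain ⟨w, hw⟩ := hy
  exact ⟨z + w, fun i => by simp [hz, hw]⟩

theorem integerPoints_zsmul {n : ℕ} (m : ℤ) {x : Fin n → ℝ} (hx : x ∈ integerPoints n) :
    (m : ℝ) • x ∈ integerPoints n := by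
  obtain ⟨z, hz⟩ := hx
  exact ⟨m • z, fun i => by simp [hz]⟩

theorem zero_mem_integerPoints (n : ℕ) : (0 : Fin n → ℝ) ∈ integerPoints n := ⟨0, by simp⟩

theorem single_mem_integerPoints {n : ℕ} (k : Fin n) :
    (Pi.single k 1 : Fin n → ℝ) ∈ integerPoints n :=
  ⟨Pi.single k 1, fun i => by by_cases h : i = k <;> simp [h]⟩

/-- The images of the standard basis are the columns of an integral matrix. This is the source of
the integer factor in the volume of a join. -/
theorem exists_int_det_of_mapsTo_integerPoints {n : ℕ} (f : (Fin n → ℝ) →ₗ[ℝ] (Fin n → ℝ))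
    (hf : ∀ x ∈ integerPoints n, f x ∈ integerPoints n) :
    ∃ m : ℤ, LinearMap.det f = m := by
  choose z hz using fun k => hf _ (single_mem_integerPoints k)
  refine ⟨(Matrix.of fun l k => z k l).det, ?_⟩
  rw [← LinearMap.det_toMatrix', ← eq_intCast (Int.castRingHom ℝ), RingHom.map_det]
  congr 1
  ext l k
  simp [LinearMap.toMatrix'_apply, hz, RingHom.mapMatrix_apply]

/-- Makes the two ends of a join, s = 0 and s = 1, negligible. -/
theorem AffineMap.volume_range_eq_zero {i d : ℕ} (hid : i < d)
    (M : (Fin i → ℝ) →ᵃ[ℝ] (Fin d → ℝ)) : MeasureTheory.volume (Set.range M) = 0 := by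
  have h := MeasureTheory.Measure.addHaar_affineSubspace
    (MeasureTheory.volume : MeasureTheory.Measure (Fin d → ℝ))
    ((⊤ : AffineSubspace ℝ (Fin i → ℝ)).map M) ?_
  · simpa using h
  · intro h
    have hs : Function.Surjective M := by
      rw [← Set.range_eq_univ]
      simpa using congrArg (fun s : AffineSubspace ℝ (Fin d → ℝ) => (s : Set (Fin d → ℝ))) h
    have := LinearMap.finrank_le_finrank_of_surjective
      (M.linear_surjective_iff.2 hs)
    simp at this
    omega

open MeasureTheory in
/-- The volume of the join of two convex sets placed by integral affine maps. -/
theorem exists_volume_convexHull_image_union {i j : ℕ}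
    (M : (Fin i → ℝ) →ᵃ[ℝ] (Fin (i + j + 1) → ℝ)) (N : (Fin j → ℝ) →ᵃ[ℝ] (Fin (i + j + 1) → ℝ))
    (hM : ∀ x ∈ integerPoints i, M x ∈ integerPoints (i + j + 1))
    (hN : ∀ x ∈ integerPoints j, N x ∈ integerPoints (i + j + 1))
    {F : Set (Fin i → ℝ)} {G : Set (Fin j → ℝ)} (hFc : Convex ℝ F) (hGc : Convex ℝ G)
    (hF : MeasurableSet F) (hG : MeasurableSet G) (hF0 : F.Nonempty) (hG0 : G.Nonempty) :
    ∃ m : ℤ, ((i + j + 1).factorial : ℝ) *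
        (volume (convexHull ℝ (M '' F ∪ N '' G))).toReal =
      m * (i.factorial * (volume F).toReal) * (j.factorial * (volume G).toReal) := by
  obtain ⟨e, hes, hep, hei⟩ := exists_measurePreserving_linearMap_prod i j
  let Z : Set (ℝ × (Fin i → ℝ) × (Fin j → ℝ)) := {z | z.1 ∈ Set.Ioo (0 : ℝ) 1 ∧
    (1 - z.1)⁻¹ • z.2.1 ∈ F ∧ z.1⁻¹ • z.2.2 ∈ G}
  obtain ⟨hZm, hZ⟩ := measure_join_slices (volume : Measure (Fin i → ℝ))
    (volume : Measure (Fin j → ℝ)) hF hG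
  change MeasurableSet Z at hZm
  -- In the coordinates `(s, (1 - s) • f, s • g)` the point `(1 - s) • M f + s • N g` is linear up
  -- to the translation by `M 0`, so the join is, up to null sets, a translate of `ψ '' Z`.
  let ψ : ℝ × (Fin i → ℝ) × (Fin j → ℝ) →ₗ[ℝ] (Fin (i + j + 1) → ℝ) :=
    ((LinearMap.toSpanSingleton ℝ _ (N 0 - M 0)).coprod (M.linear.coprod N.linear))
  have hψ : ∀ s f g, ψ (s, f, g) = s • (N 0 - M 0) + (M.linear f + N.linear g) := by
    intro s f g; simp [ψ]
  have hMlin : ∀ x, M x = M.linear x + M 0 := fun x => by simpa using congrFun M.decomp x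
  have hNlin : ∀ x, N x = N.linear x + N 0 := fun x => by simpa using congrFun N.decomp x
  obtain ⟨m, hm⟩ := exists_int_det_of_mapsTo_integerPoints (ψ ∘ₗ e) (by
    intro x hx
    obtain ⟨⟨z, hz⟩, hf, hg⟩ := hei x hx
    have : (ψ ∘ₗ e) x = ψ ((e x).1, (e x).2.1, (e x).2.2) := rfl
    rw [this, hψ, hz]
    have hM0 := hM 0 (zero_mem_integerPoints i)
    have hN0 := hN 0 (zero_mem_integerPoints j)
    refine integerPoints_add (integerPoints_zsmul z (integerPoints_sub hN0 hM0))
      (integerPoints_add ?_ ?_)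
    · rw [← add_sub_cancel_right (M.linear _) (M 0), ← hMlin]
      exact integerPoints_sub (hM _ hf) hM0
    · rw [← add_sub_cancel_right (N.linear _) (N 0), ← hNlin]
      exact integerPoints_sub (hN _ hg) hN0)
  have hvol : volume (ψ '' Z) = ENNReal.ofReal |(m : ℝ)| * volume Z := by
    have h := Measure.addHaar_image_linearMap (volume : Measure (Fin (i + j + 1) → ℝ))
      (ψ ∘ₗ e) (e ⁻¹' Z)
    rw [LinearMap.coe_comp, Set.image_comp, Set.image_preimage_eq _ hes,
      hep.measure_preimage hZm.nullMeasurableSet, hm] at h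
    exact h
  have hkey : ∀ s : ℝ, ∀ f g, ψ (s, (1 - s) • f, s • g) + M 0 = (1 - s) • M f + s • N g := by
    intro s f g
    rw [hψ, hMlin f, hNlin g, map_smul, map_smul]
    module
  have hsub : (fun y => y + M 0) '' (ψ '' Z) ⊆ convexHull ℝ (M '' F ∪ N '' G) := by
    rintro _ ⟨_, ⟨⟨s, f, g⟩, ⟨hs, hf, hg⟩, rfl⟩, rfl⟩
    have h1 : (0 : ℝ) < 1 - s := by linarith [hs.2]
    have hs0 : 0 < s := hs.1
    have := hkey s ((1 - s)⁻¹ • f) (s⁻¹ • g)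
    rw [smul_inv_smul₀ h1.ne', smul_inv_smul₀ hs0.ne'] at this
    simp only
    rw [this]
    exact convex_convexHull ℝ (M '' F ∪ N '' G) (subset_convexHull ℝ _ (Or.inl ⟨_, hf, rfl⟩))
      (subset_convexHull ℝ _ (Or.inr ⟨_, hg, rfl⟩)) h1.le hs0.le (by ring)
  have hsup : convexHull ℝ (M '' F ∪ N '' G) ⊆
      (fun y => y + M 0) '' (ψ '' Z) ∪ (Set.range M ∪ Set.range N) := by
    rw [convexHull_union (hF0.image _) (hG0.image _), (hFc.affine_image M).convexHull_eq,
      (hGc.affine_image N).convexHull_eq]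
    intro y hy
    obtain ⟨_, ⟨f, hf, rfl⟩, _, ⟨g, hg, rfl⟩, hy⟩ := mem_convexJoin.1 hy
    obtain ⟨r, s, hr, hs, hrs, rfl⟩ := hy
    obtain rfl : r = 1 - s := by linarith
    rcases hs.eq_or_lt with rfl | hs'
    · exact Or.inr (Or.inl ⟨f, by simp⟩)
    rcases hr.eq_or_lt with h0 | hr'
    · exact Or.inr (Or.inr ⟨g, by
        rw [← h0, zero_smul, zero_add, show s = 1 by linarith, one_smul]⟩)
    · refine Or.inl ⟨_, ⟨(s, (1 - s) • f, s • g), ⟨⟨hs', by linarith⟩, ?_, ?_⟩, rfl⟩, hkey s f g⟩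
      · simpa [inv_smul_smul₀ hr'.ne'] using hf
      · simpa [inv_smul_smul₀ hs'.ne'] using hg
  have hvolK : volume (convexHull ℝ (M '' F ∪ N '' G)) = volume (ψ '' Z) := by
    have htr : volume ((fun y => y + M 0) '' (ψ '' Z)) = volume (ψ '' Z) := by
      simp
    rw [← htr]
    refine le_antisymm ?_ (measure_mono hsub)
    refine (measure_mono hsup).trans ((measure_union_le _ _).trans ?_)
    rw [measure_union_null (M.volume_range_eq_zero (by omega)) (N.volume_range_eq_zero (by omega)),
      add_zero]
  have hZ' : volume Z = ENNReal.ofReal (i.factorial * j.factorial / (i + j + 1).factorial) *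
      (volume F * volume G) := by
    simp only [Module.finrank_fin_fun] at hZ
    exact hZ
  -- Volume sees the absolute value of the determinant; the factorials from the slices cancel
  -- against the normalization.
  refine ⟨|m|, ?_⟩
  rw [hvolK, hvol, hZ', ENNReal.toReal_mul, ENNReal.toReal_mul, ENNReal.toReal_mul,
    ENNReal.toReal_ofReal (abs_nonneg _), ENNReal.toReal_ofReal (by positivity)]
  push_cast
  have : ((i + j + 1).factorial : ℝ) ≠ 0 := by positivity
  field_simp

/-! ### Joins and subdivisions of lattice polytopes -/

theorem AffineMap.exists_leftInverse_of_injective {E F : Type*} [AddCommGroup E] [Module ℝ E]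
    [AddCommGroup F] [Module ℝ F] (T : E →ᵃ[ℝ] F) (hT : Function.Injective T) :
    ∃ R : F →ᵃ[ℝ] E, ∀ x, R (T x) = x := by
  obtain ⟨g, hg⟩ := LinearMap.exists_leftInverse_of_injective T.linear
    (LinearMap.ker_eq_bot.2 (T.linear_injective_iff.2 hT))
  refine ⟨g.toAffineMap - AffineMap.const ℝ F (g (T 0)), fun x => ?_⟩
  have h : T x = T.linear x + T 0 := by simpa using congrFun T.decomp x
  have hgx : g (T.linear x) = x := congrArg (fun f : E →ₗ[ℝ] E => f x) hg
  simp [h, hgx]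

theorem polytopeDim_convexHull {n : ℕ} (S : Set (Fin n → ℝ)) :
    polytopeDim (convexHull ℝ S) = Module.finrank ℝ (vectorSpan ℝ S) := by
  rw [polytopeDim, affineSpan_convexHull, direction_affineSpan]

theorem isLatticePolytope_convexHull {n : ℕ} {S : Set (Fin n → ℝ)} (hS : S.Finite)
    (h0 : S.Nonempty) (hi : S ⊆ integerPoints n) : IsLatticePolytope (convexHull ℝ S) :=
  ⟨S, hS, h0, hi, rfl⟩

theorem IsLatticePolytope.isClosed {n : ℕ} {P : Set (Fin n → ℝ)} (hP : IsLatticePolytope P) :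
    IsClosed P := by
  obtain ⟨S, hS, -, -, rfl⟩ := hP
  exact (hS.isCompact_convexHull ℝ).isClosed

theorem IsLatticePolytope.convex {n : ℕ} {P : Set (Fin n → ℝ)} (hP : IsLatticePolytope P) :
    Convex ℝ P := by
  obtain ⟨S, hS, -, -, rfl⟩ := hP
  exact convex_convexHull ℝ S

theorem IsLatticePolytope.nonempty {n : ℕ} {P : Set (Fin n → ℝ)} (hP : IsLatticePolytope P) :
    P.Nonempty := by
  obtain ⟨S, -, hS, -, rfl⟩ := hP
  exact hS.mono (subset_convexHull ℝ S)

/-- The normalized volume of a join of lattice polytopes is an integral multiple of the product of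
their normalized volumes. -/
theorem exists_normalizedVolume_join {n i j : ℕ} {F G : Set (Fin n → ℝ)}
    (hF : IsLatticePolytope F) (hG : IsLatticePolytope G)
    (hC : IsLatticePolytope (convexHull ℝ (F ∪ G)))
    (hFi : polytopeDim F = i) (hGj : polytopeDim G = j)
    (hCd : polytopeDim (convexHull ℝ (F ∪ G)) = i + j + 1) :
    ∃ m : ℤ, normalizedVolume (i + j + 1) (convexHull ℝ (F ∪ G)) =
      m * normalizedVolume i F * normalizedVolume j G := by
  obtain ⟨T, hT⟩ := exists_isLatticeChart hC hCd
  obtain ⟨R, hR⟩ := T.exists_leftInverse_of_injective hT.injective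
  -- Read in the chart `T` of the join, a chart `U` of `F` or `G` becomes `R.comp U`. It is integral
  -- because `T` maps the integer points onto all lattice points of its range.
  have key : ∀ {k : ℕ} {K : Set (Fin n → ℝ)} {U : (Fin k → ℝ) →ᵃ[ℝ] (Fin n → ℝ)},
      K ⊆ F ∪ G → IsLatticePolytope K → IsLatticeChart (affineSpan ℝ K) U →
      (∀ x, T ((R.comp U) x) = U x) ∧
      (∀ x ∈ integerPoints k, (R.comp U) x ∈ integerPoints (i + j + 1)) ∧
      Convex ℝ (U ⁻¹' K) ∧ MeasurableSet (U ⁻¹' K) ∧ (U ⁻¹' K).Nonempty ∧ U '' (U ⁻¹' K) = K := by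
    intro k K U hK hKP hU
    have hle : affineSpan ℝ K ≤ affineSpan ℝ (convexHull ℝ (F ∪ G)) :=
      affineSpan_mono ℝ (hK.trans (subset_convexHull ℝ _))
    have hKU : K ⊆ Set.range U := by rw [hU.range_eq]; exact subset_affineSpan ℝ K
    refine ⟨fun x => ?_, fun x hx => ?_, hKP.convex.affine_preimage U,
      (hKP.isClosed.preimage U.continuous_of_finiteDimensional).measurableSet, ?_,
      Set.image_preimage_eq_of_subset hKU⟩
    · have hx : U x ∈ Set.range T := by
        rw [hT.range_eq]
        exact hle (by rw [← SetLike.mem_coe, ← hU.range_eq]; exact ⟨x, rfl⟩)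
      obtain ⟨y, hy⟩ := hx
      simp [← hy, hR]
    · have h1 : U x ∈ (affineSpan ℝ K : Set (Fin n → ℝ)) ∩ integerPoints n := by
        rw [← hU.image_integerPoints]; exact ⟨x, hx, rfl⟩
      have h2 : U x ∈ T '' integerPoints (i + j + 1) := by
        rw [hT.image_integerPoints]; exact ⟨hle h1.1, h1.2⟩
      obtain ⟨y, hy, hyx⟩ := h2
      simpa [← hyx, hR] using hy
    · obtain ⟨y, hy⟩ := hKP.nonempty
      obtain ⟨x, rfl⟩ := hKU hy
      exact ⟨x, hy⟩
  obtain ⟨U, hU⟩ := exists_isLatticeChart hF hFi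
  obtain ⟨V, hV⟩ := exists_isLatticeChart hG hGj
  obtain ⟨hU1, hU2, hU3, hU4, hU5, hU6⟩ := key Set.subset_union_left hF hU
  obtain ⟨hV1, hV2, hV3, hV4, hV5, hV6⟩ := key Set.subset_union_right hG hV
  obtain ⟨m, hm⟩ := exists_volume_convexHull_image_union (R.comp U) (R.comp V) hU2 hV2 hU3 hV3
    hU4 hV4 hU5 hV5
  refine ⟨m, ?_⟩
  have hpre : T ⁻¹' convexHull ℝ (F ∪ G) =
      convexHull ℝ ((R.comp U) '' (U ⁻¹' F) ∪ (R.comp V) '' (V ⁻¹' G)) := by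
    have h : T '' convexHull ℝ ((R.comp U) '' (U ⁻¹' F) ∪ (R.comp V) '' (V ⁻¹' G)) =
        convexHull ℝ (F ∪ G) := by
      rw [T.image_convexHull, Set.image_union, Set.image_image, Set.image_image]
      simp only [hU1, hV1, hU6, hV6]
    rw [← h, Set.preimage_image_eq _ hT.injective]
  rw [normalizedVolume_eq hCd hT, normalizedVolume_eq hFi hU, normalizedVolume_eq hGj hV, hpre, hm]

/-- To place the normalized volume of a lattice polytope in a subgroup of `ℝ` it suffices to do so
for the full-dimensional cells of a regular subdivision. -/
theorem normalizedVolume_mem_of_cells {n d : ℕ} {ι : Type*} [Fintype ι] [Nonempty ι]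
    (a : ι → Fin n → ℝ) (ha : ∀ i, a i ∈ integerPoints n)
    (hd : polytopeDim (convexHull ℝ (Set.range a)) = d) (ω : ι → ℝ) (H : AddSubgroup ℝ)
    (h : ∀ f : (Fin n → ℝ) →ᵃ[ℝ] ℝ, (∀ i, f (a i) ≤ ω i) →
      affineSpan ℝ (a '' {i | f (a i) = ω i}) = affineSpan ℝ (Set.range a) →
      normalizedVolume d (convexHull ℝ (a '' {i | f (a i) = ω i})) ∈ H) :
    normalizedVolume d (convexHull ℝ (Set.range a)) ∈ H := by
  have hP : IsLatticePolytope (convexHull ℝ (Set.range a)) :=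
    isLatticePolytope_convexHull (Set.finite_range a) (Set.range_nonempty a)
      (by rintro _ ⟨i, rfl⟩; exact ha i)
  obtain ⟨T, hT⟩ := exists_isLatticeChart hP hd
  obtain ⟨R, hR⟩ := T.exists_leftInverse_of_injective hT.injective
  have hTR : ∀ i, T (R (a i)) = a i := by
    intro i
    have : a i ∈ Set.range T := by
      rw [hT.range_eq]
      exact subset_affineSpan ℝ _ (subset_convexHull ℝ _ ⟨i, rfl⟩)
    obtain ⟨x, hx⟩ := this
    rw [← hx, hR]
  have himg : ∀ I : Set ι, T '' convexHull ℝ ((R ∘ a) '' I) = convexHull ℝ (a '' I) := by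
    intro I
    rw [T.image_convexHull, Set.image_image]
    simp [hTR]
  have hpre : ∀ I : Set ι, T ⁻¹' convexHull ℝ (a '' I) = convexHull ℝ ((R ∘ a) '' I) := by
    intro I
    rw [← himg, Set.preimage_image_eq _ hT.injective]
  obtain ⟨C, hC, hvol⟩ := exists_regular_subdivision
    (MeasureTheory.volume : MeasureTheory.Measure (Fin d → ℝ)) (R ∘ a) ω
  have hsum : normalizedVolume d (convexHull ℝ (Set.range a)) =
      ∑ I ∈ C, (d.factorial : ℝ) *
        (MeasureTheory.volume (convexHull ℝ ((R ∘ a) '' I))).toReal := by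
    rw [normalizedVolume_eq hd hT, ← Finset.mul_sum, ← ENNReal.toReal_sum, ← hvol]
    · rw [← Set.image_univ, hpre, Set.image_univ]
    · intro I _
      exact ((Set.toFinite _).isCompact_convexHull ℝ).measure_lt_top.ne
  rw [hsum]
  refine H.sum_mem fun I hI => ?_
  obtain ⟨hspan, f, hf, rfl⟩ := hC I hI
  have hspan' : affineSpan ℝ (a '' {i | f ((R ∘ a) i) = ω i}) = affineSpan ℝ (Set.range a) := by
    have h1 : affineSpan ℝ (a '' {i | f ((R ∘ a) i) = ω i}) =
        (affineSpan ℝ ((R ∘ a) '' {i | f ((R ∘ a) i) = ω i})).map T := by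
      rw [AffineSubspace.map_span, Set.image_image]
      simp [hTR]
    rw [h1, hspan]
    apply SetLike.coe_injective
    rw [AffineSubspace.coe_map, AffineSubspace.top_coe, Set.image_univ, hT.range_eq,
      affineSpan_convexHull]
  have hmem := h (f.comp R) hf hspan'
  have hdim : polytopeDim (convexHull ℝ (a '' {i | f ((R ∘ a) i) = ω i})) = d := by
    rw [polytopeDim, affineSpan_convexHull, hspan', ← affineSpan_convexHull]
    exact hd
  have hT' : IsLatticeChart (affineSpan ℝ (convexHull ℝ (a '' {i | f ((R ∘ a) i) = ω i}))) T := by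
    rw [affineSpan_convexHull, hspan', ← affineSpan_convexHull]
    exact hT
  rw [← hpre, ← normalizedVolume_eq hdim hT']
  exact hmem

/-! ### Skew position and mixed cells -/

/-- The linear span of a set placed at height one. -/
def homogeneousSpan {E : Type*} [AddCommGroup E] [Module ℝ E] (S : Set E) :
    Submodule ℝ (E × ℝ) :=
  Submodule.span ℝ ((fun x => (x, (1 : ℝ))) '' S)

theorem homogeneousSpan_union {E : Type*} [AddCommGroup E] [Module ℝ E] (S S' : Set E) :
    homogeneousSpan (S ∪ S') = homogeneousSpan S ⊔ homogeneousSpan S' := by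
  rw [homogeneousSpan, Set.image_union, Submodule.span_union]; rfl

/-- For q in S the span splits into the direction of the affine hull, with last coordinate 0, and
the line through (q, 1). -/
theorem finrank_homogeneousSpan {E : Type*} [AddCommGroup E] [Module ℝ E]
    [FiniteDimensional ℝ E] {S : Set E} (hS : S.Nonempty) :
    Module.finrank ℝ (homogeneousSpan S) = Module.finrank ℝ (vectorSpan ℝ S) + 1 := by
  obtain ⟨q, hq⟩ := hS
  have heq : homogeneousSpan S =
      (vectorSpan ℝ S).map (LinearMap.inl ℝ E ℝ) ⊔ Submodule.span ℝ {(q, (1 : ℝ))} := by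
    apply le_antisymm
    · refine Submodule.span_le.2 ?_
      rintro _ ⟨x, hx, rfl⟩
      refine Submodule.mem_sup.2 ⟨(x - q, 0), ⟨x - q, vsub_mem_vectorSpan ℝ hx hq, rfl⟩,
        (q, 1), Submodule.mem_span_singleton_self _, by simp⟩
    · refine sup_le ?_ ?_
      · rw [vectorSpan_eq_span_vsub_set_right ℝ hq, Submodule.map_span, Submodule.span_le]
        rintro _ ⟨_, ⟨x, hx, rfl⟩, rfl⟩
        have : LinearMap.inl ℝ E ℝ (x -ᵥ q) = (x, 1) - (q, 1) := by simp
        rw [SetLike.mem_coe, this]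
        exact sub_mem (Submodule.subset_span ⟨x, hx, rfl⟩) (Submodule.subset_span ⟨q, hq, rfl⟩)
      · rw [Submodule.span_singleton_le_iff_mem]
        exact Submodule.subset_span ⟨q, hq, rfl⟩
  have hdis : Disjoint ((vectorSpan ℝ S).map (LinearMap.inl ℝ E ℝ))
      (Submodule.span ℝ {(q, (1 : ℝ))}) := by
    rw [Submodule.disjoint_def]
    rintro _ ⟨x, -, rfl⟩ hx
    obtain ⟨c, hc⟩ := Submodule.mem_span_singleton.1 hx
    have h2 : c = 0 := by simpa using congrArg Prod.snd hc
    rw [← hc, h2, zero_smul]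
  have h := Submodule.finrank_sup_add_finrank_inf_eq ((vectorSpan ℝ S).map (LinearMap.inl ℝ E ℝ))
    (Submodule.span ℝ {(q, (1 : ℝ))})
  rw [hdis.eq_bot, finrank_bot, add_zero, ← heq, finrank_span_singleton (by simp),
    ← (Submodule.equivMapOfInjective _ LinearMap.inl_injective (vectorSpan ℝ S)).finrank_eq] at h
  exact h

/-- Disjoint homogeneous spans have additive ranks; each rank exceeds the affine dimension by one,
which leaves the summand 1. -/
theorem finrank_vectorSpan_union {E : Type*} [AddCommGroup E] [Module ℝ E]
    [FiniteDimensional ℝ E] {S S' : Set E} (hS : S.Nonempty) (hS' : S'.Nonempty)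
    (h : Disjoint (homogeneousSpan S) (homogeneousSpan S')) :
    Module.finrank ℝ (vectorSpan ℝ (S ∪ S')) =
      Module.finrank ℝ (vectorSpan ℝ S) + Module.finrank ℝ (vectorSpan ℝ S') + 1 := by
  have h1 := Submodule.finrank_sup_add_finrank_inf_eq (homogeneousSpan S) (homogeneousSpan S')
  rw [h.eq_bot, finrank_bot, add_zero, ← homogeneousSpan_union, finrank_homogeneousSpan hS,
    finrank_homogeneousSpan hS', finrank_homogeneousSpan (hS.mono Set.subset_union_left)] at h1
  omega

theorem exists_ne_zero_mem_of_not_disjoint {E : Type*} [AddCommGroup E] [Module ℝ E]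
    {p q : Submodule ℝ E} (h : ¬ Disjoint p q) : ∃ w, w ∈ p ∧ w ∈ q ∧ w ≠ 0 := by
  rw [Submodule.disjoint_def] at h
  push Not at h
  exact h

/-- If `f` vanishes on `S` and agrees on `S'` with a functional that does not vanish on the
intersection of the homogeneous spans, then that intersection is trivial. -/
theorem disjoint_homogeneousSpan_of_affineMap {E : Type*} [AddCommGroup E] [Module ℝ E]
    {S S' : Set E} (ψ : E × ℝ →ₗ[ℝ] ℝ)
    (hψ : ¬ Disjoint (homogeneousSpan S) (homogeneousSpan S') →
      ∃ w ∈ homogeneousSpan S, w ∈ homogeneousSpan S' ∧ ψ w ≠ 0)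
    (f : E →ᵃ[ℝ] ℝ) (hS : ∀ x ∈ S, f x = 0) (hS' : ∀ x ∈ S', f x = ψ (x, 1)) :
    Disjoint (homogeneousSpan S) (homogeneousSpan S') := by
  by_contra hdis
  obtain ⟨w, hw, hw', h0⟩ := hψ hdis
  -- The linear extension of `f`, with `φ (x, 1) = f x`: at `w` it would have to be both 0 and `ψ
  -- w`.
  let φ : E × ℝ →ₗ[ℝ] ℝ := f.linear.coprod (LinearMap.toSpanSingleton ℝ ℝ (f 0))
  have hφ : ∀ x, φ (x, 1) = f x := fun x => by
    have : f x = f.linear x + f 0 := by simpa using congrFun f.decomp x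
    simp [φ, this]
  have h1 : homogeneousSpan S ≤ LinearMap.ker φ := by
    refine Submodule.span_le.2 ?_
    rintro _ ⟨x, hx, rfl⟩
    simp [hφ, hS x hx]
  have h2 : homogeneousSpan S' ≤ LinearMap.ker (φ - ψ) := by
    refine Submodule.span_le.2 ?_
    rintro _ ⟨x, hx, rfl⟩
    simp [hφ, hS' x hx]
  have h3 : φ w = 0 := h1 hw
  have h4 : φ w - ψ w = 0 := h2 hw'
  exact h0 (by linarith)

/-- Mixed subdivision of the convex hull of two lattice polytopes: for a functional `ψ` in general
position, the cells are joins of a face of the first and a face of the second polytope. -/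
theorem normalizedVolume_mem_of_mixed_cells {n d : ℕ} {S S' : Set (Fin n → ℝ)}
    (hSf : S.Finite) (hSf' : S'.Finite) (hS : S ⊆ integerPoints n) (hS' : S' ⊆ integerPoints n)
    (h0 : S.Nonempty) (hd : polytopeDim (convexHull ℝ (S ∪ S')) = d)
    (ψ : (Fin n → ℝ) × ℝ →ₗ[ℝ] ℝ)
    (hψ : ∀ I ⊆ S, ∀ J ⊆ S', ¬ Disjoint (homogeneousSpan I) (homogeneousSpan J) →
      ∃ w ∈ homogeneousSpan I, w ∈ homogeneousSpan J ∧ ψ w ≠ 0)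
    (H : AddSubgroup ℝ)
    (hleft : ∀ f : (Fin n → ℝ) →ᵃ[ℝ] ℝ, (∀ x ∈ S, f x ≤ 0) → (∀ x ∈ S', f x ≤ ψ (x, 1)) →
      affineSpan ℝ {x ∈ S | f x = 0} = affineSpan ℝ (S ∪ S') →
      normalizedVolume d (convexHull ℝ {x ∈ S | f x = 0}) ∈ H)
    (hright : ∀ f : (Fin n → ℝ) →ᵃ[ℝ] ℝ, (∀ x ∈ S, f x ≤ 0) → (∀ x ∈ S', f x ≤ ψ (x, 1)) →
      affineSpan ℝ {x ∈ S' | f x = ψ (x, 1)} = affineSpan ℝ (S ∪ S') →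
      normalizedVolume d (convexHull ℝ {x ∈ S' | f x = ψ (x, 1)}) ∈ H)
    (hjoin : ∀ f : (Fin n → ℝ) →ᵃ[ℝ] ℝ, (∀ x ∈ S, f x ≤ 0) → (∀ x ∈ S', f x ≤ ψ (x, 1)) →
      {x ∈ S | f x = 0}.Nonempty → {x ∈ S' | f x = ψ (x, 1)}.Nonempty →
      polytopeDim (convexHull ℝ {x ∈ S | f x = 0}) +
        polytopeDim (convexHull ℝ {x ∈ S' | f x = ψ (x, 1)}) + 1 = d →
      normalizedVolume (polytopeDim (convexHull ℝ {x ∈ S | f x = 0}))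
          (convexHull ℝ {x ∈ S | f x = 0}) *
        normalizedVolume (polytopeDim (convexHull ℝ {x ∈ S' | f x = ψ (x, 1)}))
          (convexHull ℝ {x ∈ S' | f x = ψ (x, 1)}) ∈ H) :
    normalizedVolume d (convexHull ℝ (S ∪ S')) ∈ H := by
  have := hSf.fintype
  have := hSf'.fintype
  have : Nonempty (S ⊕ S') := ⟨Sum.inl ⟨h0.some, h0.some_mem⟩⟩
  -- A disjoint sum, because a point of `S ∩ S'` carries two heights.
  let a : S ⊕ S' → Fin n → ℝ := Sum.elim (↑) (↑)
  let ω : S ⊕ S' → ℝ := Sum.elim (fun _ => 0) (fun x => ψ (x, 1))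
  have hrange : Set.range a = S ∪ S' := by simp [a]
  have hact : ∀ f : (Fin n → ℝ) →ᵃ[ℝ] ℝ, a '' {i | f (a i) = ω i} =
      {x ∈ S | f x = 0} ∪ {x ∈ S' | f x = ψ (x, 1)} := by
    intro f
    ext x
    simp [a, ω, and_comm]
  rw [← hrange] at hd ⊢
  refine normalizedVolume_mem_of_cells a ?_ hd ω H fun f hf hspan => ?_
  · rintro (x | x)
    exacts [hS x.2, hS' x.2]
  rw [hact, hrange] at hspan
  rw [hact]
  rw [hrange] at hd
  have hf1 : ∀ x ∈ S, f x ≤ 0 := fun x hx => hf (Sum.inl ⟨x, hx⟩)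
  have hf2 : ∀ x ∈ S', f x ≤ ψ (x, 1) := fun x hx => hf (Sum.inr ⟨x, hx⟩)
  set I := {x ∈ S | f x = 0} with hI
  set J := {x ∈ S' | f x = ψ (x, 1)} with hJ
  rcases J.eq_empty_or_nonempty with hJ0 | hJ0
  · rw [hJ0, Set.union_empty] at hspan ⊢
    exact hleft f hf1 hf2 hspan
  rcases I.eq_empty_or_nonempty with hI0 | hI0
  · rw [hI0, Set.empty_union] at hspan ⊢
    exact hright f hf1 hf2 hspan
  have hIS : I ⊆ S := fun x hx => hx.1
  have hJS : J ⊆ S' := fun x hx => hx.1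
  have hdis : Disjoint (homogeneousSpan I) (homogeneousSpan J) :=
    disjoint_homogeneousSpan_of_affineMap ψ (hψ I hIS J hJS) f (fun x hx => hx.2) fun x hx => hx.2
  have hdim : polytopeDim (convexHull ℝ I) + polytopeDim (convexHull ℝ J) + 1 = d := by
    rw [polytopeDim_convexHull, polytopeDim_convexHull, ← finrank_vectorSpan_union hI0 hJ0 hdis,
      ← direction_affineSpan, hspan, ← hd, polytopeDim, affineSpan_convexHull]
  have hmem := hjoin f hf1 hf2 hI0 hJ0 hdim
  have hIJ : convexHull ℝ (convexHull ℝ I ∪ convexHull ℝ J) = convexHull ℝ (I ∪ J) :=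
    (convexHull ℝ).closure_sup_closure I J
  have hlI := isLatticePolytope_convexHull (hSf.subset hIS) hI0 (hIS.trans hS)
  have hlJ := isLatticePolytope_convexHull (hSf'.subset hJS) hJ0 (hJS.trans hS')
  have hlIJ := isLatticePolytope_convexHull ((hSf.subset hIS).union (hSf'.subset hJS))
    (hI0.mono Set.subset_union_left) (Set.union_subset (hIS.trans hS) (hJS.trans hS'))
  have hdIJ : polytopeDim (convexHull ℝ (I ∪ J)) =
      polytopeDim (convexHull ℝ I) + polytopeDim (convexHull ℝ J) + 1 := by
    rw [hdim, ← hd, polytopeDim, polytopeDim, affineSpan_convexHull, affineSpan_convexHull, hspan]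
  rw [← hIJ] at hlIJ hdIJ
  obtain ⟨m, hm⟩ := exists_normalizedVolume_join hlI hlJ hlIJ rfl rfl hdIJ
  rw [hIJ, hdim] at hm
  rw [hm, mul_assoc, ← zsmul_eq_mul]
  exact H.zsmul_mem hmem m

/-! ### Faces -/

/-- The points of a convex hull where an affine function that is nonpositive on the generators
vanishes are spanned by the generators with that property. -/
theorem convexHull_setOf_eq_zero {E : Type*} [AddCommGroup E] [Module ℝ E] {S : Set E}
    (f : E →ᵃ[ℝ] ℝ) (hf : ∀ x ∈ S, f x ≤ 0) :
    convexHull ℝ {x ∈ S | f x = 0} = {x ∈ convexHull ℝ S | f x = 0} := by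
  apply Set.Subset.antisymm
  · refine convexHull_min (fun x hx => ⟨subset_convexHull ℝ S hx.1, hx.2⟩) ?_
    exact (convex_convexHull ℝ S).inter ((convex_singleton (0 : ℝ)).affine_preimage f)
  · rintro x ⟨hx, hx0⟩
    obtain ⟨ι, _, w, z, hw, hw1, hz, rfl⟩ := mem_convexHull_iff_exists_fintype.1 hx
    rw [f.map_sum_of_sum_eq_one z hw1] at hx0
    have hzero := (Finset.sum_eq_zero_iff_of_nonpos
      (fun i _ => mul_nonpos_of_nonneg_of_nonpos (hw i) (hf _ (hz i)))).1 hx0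
    refine sum_smul_mem_convexHull hw hw1 fun i hi => ⟨hz i, ?_⟩
    exact (mul_eq_zero.1 (hzero i (Finset.mem_univ i))).resolve_left hi

theorem isExposed_convexHull_setOf {n : ℕ} {S : Set (Fin n → ℝ)}
    (f : (Fin n → ℝ) →ᵃ[ℝ] ℝ) (hf : ∀ x ∈ S, f x ≤ 0) :
    IsExposed ℝ (convexHull ℝ S) (convexHull ℝ {x ∈ S | f x = 0}) := by
  rw [convexHull_setOf_eq_zero f hf]
  rintro ⟨q, hq, hq0⟩
  have hle : ∀ x ∈ convexHull ℝ S, f x ≤ 0 := fun x hx => by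
    simpa using f.le_of_mem_convexHull (AffineMap.const ℝ _ 0) (by simpa using hf) hx
  have hdec : ∀ x, f x = f.linear x + f 0 := fun x => by simpa using congrFun f.decomp x
  refine ⟨LinearMap.toContinuousLinearMap f.linear, ?_⟩
  ext x
  simp only [Set.mem_ofPred_eq, LinearMap.coe_toContinuousLinearMap', and_congr_right_iff]
  intro hx
  constructor
  · intro h0 y hy
    have := hle y hy
    rw [hdec] at this h0
    linarith
  · intro h
    have h1 := h q hq
    have h2 := hle x hx
    rw [hdec] at hq0 h2 ⊢
    linarith

theorem IsExposed.exists_affineMap {n : ℕ} {S F : Set (Fin n → ℝ)}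
    (hF : IsExposed ℝ (convexHull ℝ S) F) (h0 : F.Nonempty) :
    ∃ f : (Fin n → ℝ) →ᵃ[ℝ] ℝ, (∀ x ∈ S, f x ≤ 0) ∧ F = convexHull ℝ {x ∈ S | f x = 0} := by
  obtain ⟨l, rfl⟩ := hF h0
  obtain ⟨q, hq, hql⟩ := h0
  let f : (Fin n → ℝ) →ᵃ[ℝ] ℝ := l.toLinearMap.toAffineMap - AffineMap.const ℝ _ (l q)
  have hfx : ∀ x, f x = l x - l q := fun x => by simp [f]
  have hf : ∀ x ∈ S, f x ≤ 0 := fun x hx => by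
    rw [hfx]
    linarith [hql x (subset_convexHull ℝ S hx)]
  refine ⟨f, hf, ?_⟩
  rw [convexHull_setOf_eq_zero f hf]
  ext x
  simp only [Set.mem_ofPred_eq, hfx, and_congr_right_iff]
  intro hx
  constructor
  · intro h
    linarith [h q hq, hql x hx]
  · intro h y hy
    linarith [hql y hy]

/-- Faces of faces of a polytope are faces. -/
theorem IsExposed.trans_of_finite {n : ℕ} {S F G : Set (Fin n → ℝ)} (hS : S.Finite)
    (hF : IsExposed ℝ (convexHull ℝ S) F) (hG : IsExposed ℝ F G) :
    IsExposed ℝ (convexHull ℝ S) G := by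
  rcases G.eq_empty_or_nonempty with rfl | hG0
  · exact isExposed_empty
  obtain ⟨f, hf, rfl⟩ := hF.exists_affineMap (hG0.mono hG.subset)
  obtain ⟨g, hg, rfl⟩ := hG.exists_affineMap hG0
  -- `f` is negative at the finitely many points of `S` off the first face, so a large multiple of
  -- it outweighs `g` there; `N • f + g` then cuts out the smaller face.
  have hN : ∃ N : ℝ, ∀ x ∈ S, f x ≠ 0 → N * f x + g x < 0 := by
    obtain ⟨N, hN⟩ := (hS.image fun x => -(g x + 1) / f x).bddAbove
    refine ⟨N, fun x hx h0 => ?_⟩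
    have hneg : f x < 0 := lt_of_le_of_ne (hf x hx) h0
    have h1 := hN ⟨x, hx, rfl⟩
    have h2 := (div_le_iff_of_neg hneg).1 h1
    linarith
  obtain ⟨N, hN⟩ := hN
  have hval : ∀ x, (N • f + g) x = N * f x + g x := fun x => by simp
  have hle : ∀ x ∈ S, (N • f + g) x ≤ 0 := by
    intro x hx
    rw [hval]
    by_cases h0 : f x = 0
    · simpa [h0] using hg x ⟨hx, h0⟩
    · exact (hN x hx h0).le
  have hset : {x ∈ {x ∈ S | f x = 0} | g x = 0} = {x ∈ S | (N • f + g) x = 0} := by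
    ext x
    simp only [Set.mem_ofPred_eq, hval]
    constructor
    · rintro ⟨⟨hx, h1⟩, h2⟩
      exact ⟨hx, by rw [h1, h2]; ring⟩
    · rintro ⟨hx, h1⟩
      have h0 : f x = 0 := by
        by_contra h0
        exact (hN x hx h0).ne h1
      refine ⟨⟨hx, h0⟩, ?_⟩
      simpa [h0] using h1
  rw [hset]
  exact isExposed_convexHull_setOf _ hle

theorem IsExposed.isLatticePolytope {n : ℕ} {S F : Set (Fin n → ℝ)} (hS : S.Finite)
    (hi : S ⊆ integerPoints n) (hF : IsExposed ℝ (convexHull ℝ S) F) (h0 : F.Nonempty) :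
    IsLatticePolytope F := by
  obtain ⟨f, -, rfl⟩ := hF.exists_affineMap h0
  exact isLatticePolytope_convexHull (hS.subset fun x hx => hx.1) (convexHull_nonempty_iff.1 h0)
    fun x hx => hi hx.1

/-! ### Integrality and passage to larger faces -/

theorem nonempty_of_polytopeDim_ne_zero {n : ℕ} {P : Set (Fin n → ℝ)} (h : polytopeDim P ≠ 0) :
    P.Nonempty := by
  rw [Set.nonempty_iff_ne_empty]
  rintro rfl
  simp [polytopeDim] at h

theorem normalizedVolume_zero {n : ℕ} {P : Set (Fin n → ℝ)} (hP : IsLatticePolytope P)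
    (hd : polytopeDim P = 0) : normalizedVolume 0 P = 1 := by
  obtain ⟨T, hT⟩ := exists_isLatticeChart hP hd
  have hpre : T ⁻¹' P = Set.univ := by
    obtain ⟨q, hq⟩ := hP.nonempty
    have : q ∈ Set.range T := by rw [hT.range_eq]; exact subset_affineSpan ℝ P hq
    obtain ⟨x, rfl⟩ := this
    refine Set.eq_univ_of_forall fun y => ?_
    rw [Subsingleton.elim y x]
    exact hq
  rw [normalizedVolume_eq hd hT, hpre, MeasureTheory.volume_pi,
    MeasureTheory.Measure.pi_univ]
  simp

/-- Decomposition into pyramids over the facets. -/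
theorem normalizedVolume_mem_of_facets {n d : ℕ} {P : Set (Fin n → ℝ)}
    (hP : IsLatticePolytope P) (hd : polytopeDim P = d + 1) (H : AddSubgroup ℝ)
    (h : ∀ F, IsExposed ℝ P F → polytopeDim F = d → normalizedVolume d F ∈ H) :
    normalizedVolume (d + 1) P ∈ H := by
  obtain ⟨S, hSf, ⟨v, hv⟩, hS, rfl⟩ := hP
  have hun : S ∪ {v} = S := Set.union_eq_left.2 (by simpa using hv)
  have hconst : ∀ x : Fin n → ℝ, (-LinearMap.snd ℝ (Fin n → ℝ) ℝ) (x, 1) = -1 := fun x => by simp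
  have hpt : ∀ f : (Fin n → ℝ) →ᵃ[ℝ] ℝ, {x ∈ ({v} : Set (Fin n → ℝ)) |
      f x = (-LinearMap.snd ℝ (Fin n → ℝ) ℝ) (x, 1)} ⊆ {v} := fun f x hx => hx.1
  rw [← hun]
  -- A second copy of `v` is placed at height -1, below the height 0 of `S`; the full-dimensional
  -- cells are then pyramids with apex `v` over facets avoiding `v`.
  refine normalizedVolume_mem_of_mixed_cells hSf (Set.finite_singleton v) hS
    (by simpa using hS hv) ⟨v, hv⟩ (by rwa [hun]) (-LinearMap.snd ℝ (Fin n → ℝ) ℝ) ?_ H ?_ ?_ ?_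
  · intro I _ J hJ hdis
    obtain ⟨w, hw, hw', h0⟩ := exists_ne_zero_mem_of_not_disjoint hdis
    refine ⟨w, hw, hw', ?_⟩
    have : w ∈ Submodule.span ℝ {(v, (1 : ℝ))} := by
      have := Submodule.span_mono (R := ℝ) (Set.image_mono (f := fun x => (x, (1 : ℝ))) hJ) hw'
      simpa using this
    obtain ⟨c, rfl⟩ := Submodule.mem_span_singleton.1 this
    intro hc
    apply h0
    have : c = 0 := by simpa using hc
    rw [this, zero_smul]
  · intro f hf hfv hspan
    exfalso
    -- A spanning cell without the apex would force `f v = 0`, against `f v ≤ -1`.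
    have hmem : v ∈ affineSpan ℝ {x ∈ S | f x = 0} := by
      rw [hspan, hun]; exact subset_affineSpan ℝ S hv
    have hle : affineSpan ℝ {x ∈ S | f x = 0} ≤
        (AffineSubspace.mk' (0 : ℝ) (⊥ : Submodule ℝ ℝ)).comap f := by
      rw [affineSpan_le]
      intro x hx
      simpa using hx.2
    have h0 : f v = 0 := by simpa using hle hmem
    have h1 := hfv v rfl
    rw [hconst] at h1
    linarith
  · intro f hf hfv hspan
    exfalso
    have h1 : polytopeDim (convexHull ℝ S) = Module.finrank ℝ (vectorSpan ℝ
        {x ∈ ({v} : Set (Fin n → ℝ)) | f x = (-LinearMap.snd ℝ (Fin n → ℝ) ℝ) (x, 1)}) := by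
      rw [polytopeDim, affineSpan_convexHull, ← direction_affineSpan, hspan, hun]
    have h2 := Submodule.finrank_mono (vectorSpan_mono ℝ (hpt f))
    rw [vectorSpan_singleton, finrank_bot] at h2
    omega
  · intro f hf hfv hI hJ hdim
    have hJv := hJ.subset_singleton_iff.1 (hpt f)
    have hlJ : IsLatticePolytope (convexHull ℝ {v}) :=
      isLatticePolytope_convexHull (Set.finite_singleton v) (Set.singleton_nonempty v)
        (by simpa using hS hv)
    have hdJ : polytopeDim (convexHull ℝ {v}) = 0 := by
      rw [polytopeDim_convexHull, vectorSpan_singleton, finrank_bot]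
    rw [hJv, hdJ] at hdim ⊢
    have hdI : polytopeDim (convexHull ℝ {x ∈ S | f x = 0}) = d := by omega
    rw [normalizedVolume_zero hlJ hdJ, mul_one, hdI]
    exact h _ (isExposed_convexHull_setOf f hf) hdI

theorem normalizedVolume_mem_zmultiples_one {n : ℕ} (d : ℕ) {P : Set (Fin n → ℝ)}
    (hP : IsLatticePolytope P) (hd : polytopeDim P = d) :
    normalizedVolume d P ∈ AddSubgroup.zmultiples (1 : ℝ) := by
  induction d generalizing P with
  | zero =>
    rw [normalizedVolume_zero hP hd]
    exact AddSubgroup.mem_zmultiples 1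
  | succ d ih =>
    refine normalizedVolume_mem_of_facets hP hd _ fun F hF hFd => ?_
    -- The empty set is exposed and has `polytopeDim` 0, so it occurs here; having no chart, it gets
    -- the default volume 0.
    rcases F.eq_empty_or_nonempty with rfl | h0
    · have hn : ¬ ∃ T : (Fin d → ℝ) →ᵃ[ℝ] (Fin n → ℝ),
          IsLatticeChart (affineSpan ℝ (∅ : Set (Fin n → ℝ))) T := by
        rintro ⟨T, hT⟩
        have := hT.range_eq
        simp at this
      rw [normalizedVolume, dif_neg fun h => hn h.2]
      exact zero_mem _
    · obtain ⟨S, hS, -, hi, rfl⟩ := hP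
      exact ih (hF.isLatticePolytope hS hi h0) hFd

/-- A subgroup that contains the normalized volumes of all `k`-dimensional faces contains those of
all faces of higher dimension. -/
theorem normalizedVolume_mem_of_faces {n k : ℕ} {P : Set (Fin n → ℝ)}
    (hP : IsLatticePolytope P) (H : AddSubgroup ℝ)
    (h : ∀ F, IsExposed ℝ P F → polytopeDim F = k → normalizedVolume k F ∈ H) {d : ℕ}
    (hkd : k ≤ d) {F : Set (Fin n → ℝ)} (hF : IsExposed ℝ P F) (hFd : polytopeDim F = d) :
    normalizedVolume d F ∈ H := by
  obtain ⟨S, hS, -, hi, rfl⟩ := hP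
  induction d, hkd using Nat.le_induction generalizing F with
  | base => exact h F hF hFd
  | succ d hkd ih =>
    have h0 := nonempty_of_polytopeDim_ne_zero (P := F) (by omega)
    exact normalizedVolume_mem_of_facets (hF.isLatticePolytope hS hi h0) hFd H
      fun G hG hGd => ih hGd (hF.trans_of_finite hS hG)

/-! ### General position and conclusion -/

/-- A functional in general position with respect to two finite sets. -/
theorem exists_functional_general_position {E : Type*} [AddCommGroup E] [Module ℝ E]
    [FiniteDimensional ℝ E] {S S' : Set E} (hS : S.Finite) (hS' : S'.Finite) :
    ∃ ψ : E × ℝ →ₗ[ℝ] ℝ, ∀ I ⊆ S, ∀ J ⊆ S',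
      ¬ Disjoint (homogeneousSpan I) (homogeneousSpan J) →
      ∃ w ∈ homogeneousSpan I, w ∈ homogeneousSpan J ∧ ψ w ≠ 0 := by
  have hfin : {q : Set E × Set E | (q.1 ⊆ S ∧ q.2 ⊆ S') ∧
      ¬ Disjoint (homogeneousSpan q.1) (homogeneousSpan q.2)}.Finite :=
    (hS.finite_subsets.prod hS'.finite_subsets).subset fun q hq => hq.1
  have := hfin.to_subtype
  choose! w hw hw' hw0 using fun (q : Set E × Set E)
    (hq : ¬ Disjoint (homogeneousSpan q.1) (homogeneousSpan q.2)) =>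
      exists_ne_zero_mem_of_not_disjoint hq
  obtain ⟨ψ, hψ⟩ := Module.exists_dual_forall_apply_ne_zero (K := ℝ)
    (fun q : {q : Set E × Set E | (q.1 ⊆ S ∧ q.2 ⊆ S') ∧
      ¬ Disjoint (homogeneousSpan q.1) (homogeneousSpan q.2)} => w q) fun q => hw0 _ q.2.2
  exact ⟨ψ, fun I hI J hJ hdis => ⟨w (I, J), hw (I, J) hdis, hw' (I, J) hdis,
    hψ ⟨(I, J), ⟨hI, hJ⟩, hdis⟩⟩⟩

/-- Since ψ(x, 1) is affine in x, subtracting it from f reduces to the zero set of a nonpositive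
function. -/
theorem isExposed_convexHull_setOf_eq {n : ℕ} {S : Set (Fin n → ℝ)}
    (ψ : (Fin n → ℝ) × ℝ →ₗ[ℝ] ℝ) (f : (Fin n → ℝ) →ᵃ[ℝ] ℝ) (hf : ∀ x ∈ S, f x ≤ ψ (x, 1)) :
    IsExposed ℝ (convexHull ℝ S) (convexHull ℝ {x ∈ S | f x = ψ (x, 1)}) := by
  let g : (Fin n → ℝ) →ᵃ[ℝ] ℝ := (ψ ∘ₗ LinearMap.inl ℝ _ ℝ).toAffineMap +
    AffineMap.const ℝ _ (ψ (0, 1))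
  have hg : ∀ x, g x = ψ (x, 1) := fun x => by simp [g, ← map_add]
  have h := isExposed_convexHull_setOf (S := S) (f - g) fun x hx => by
    simpa [hg] using hf x hx
  simpa [hg, sub_eq_zero] using h

theorem mainTheorem8 (n p t : ℕ) (hp : p.Prime) (ht : 1 ≤ t) (hn : p ^ t ≤ n)
    (A B : Set (Fin n → ℝ))
    (hA : A ∈ latticePolytopes n (p ^ t)) (hB : B ∈ latticePolytopes n (p ^ t))
    (hP : convexHull ℝ (A ∪ B) ∈ latticePolytopes n (p ^ t))
    (hFA : ∀ F : Set (Fin n → ℝ), IsExposed ℝ A F → polytopeDim F = p ^ (t - 1) →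
      ∃ k : ℤ, normalizedVolume (p ^ (t - 1)) F = (p : ℝ) * k)
    (hFB : ∀ F : Set (Fin n → ℝ), IsExposed ℝ B F → polytopeDim F = p ^ (t - 1) →
      ∃ k : ℤ, normalizedVolume (p ^ (t - 1)) F = (p : ℝ) * k) :
    ∃ k : ℤ, normalizedVolume (p ^ t) (convexHull ℝ (A ∪ B)) = (p : ℝ) * k := by
  set H := AddSubgroup.zmultiples (p : ℝ) with hH
  have hmem : ∀ x : ℝ, x ∈ H ↔ ∃ k : ℤ, x = (p : ℝ) * k := fun x => by
    rw [hH, AddSubgroup.mem_zmultiples_iff]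
    simp only [zsmul_eq_mul, mul_comm, eq_comm]
  simp only [← hmem] at hFA hFB ⊢
  by_cases hd : polytopeDim (convexHull ℝ (A ∪ B)) = p ^ t
  swap
  · rw [normalizedVolume, dif_neg fun h => hd h.1]
    exact zero_mem _
  -- Hence `i + j + 1 = p ^ t` is impossible with both `i` and `j` below `p ^ (t - 1)`.
  have hkt : 2 * p ^ (t - 1) ≤ p ^ t := by
    obtain ⟨s, rfl⟩ := Nat.exists_eq_add_of_le' ht
    rw [Nat.add_sub_cancel, pow_succ, mul_comm]
    exact Nat.mul_le_mul_left _ hp.two_le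
  have hfaceA := @normalizedVolume_mem_of_faces n _ A hA.1 H hFA
  have hfaceB := @normalizedVolume_mem_of_faces n _ B hB.1 H hFB
  have hmul : ∀ x ∈ H, ∀ y ∈ AddSubgroup.zmultiples (1 : ℝ), x * y ∈ H := by
    rintro x hx _ ⟨m, rfl⟩
    have : x * (m • (1 : ℝ)) = m • x := by simp [mul_comm]
    exact this ▸ H.zsmul_mem hx m
  obtain ⟨S, hSf, hS0, hS, rfl⟩ := hA.1
  obtain ⟨S', hSf', hS0', hS', rfl⟩ := hB.1
  have hun : convexHull ℝ (convexHull ℝ S ∪ convexHull ℝ S') = convexHull ℝ (S ∪ S') :=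
    (convexHull ℝ).closure_sup_closure S S'
  rw [hun] at hd ⊢
  obtain ⟨ψ, hψ⟩ := exists_functional_general_position hSf hSf'
  refine normalizedVolume_mem_of_mixed_cells hSf hSf' hS hS' hS0 hd ψ hψ H ?_ ?_ ?_
  · intro f hf _ hspan
    -- A cell with points of `S` only is a face of A of dimension `p ^ t`.
    refine hfaceA (by omega) (isExposed_convexHull_setOf f hf) ?_
    rw [← hd, polytopeDim, polytopeDim, affineSpan_convexHull, affineSpan_convexHull, hspan]
  · intro f _ hf hspan
    refine hfaceB (by omega) (isExposed_convexHull_setOf_eq ψ f hf) ?_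
    rw [← hd, polytopeDim, polytopeDim, affineSpan_convexHull, affineSpan_convexHull, hspan]
  · intro f hf hf' hI hJ hdim
    have hFI := isExposed_convexHull_setOf f hf
    have hFJ := isExposed_convexHull_setOf_eq ψ f hf'
    rcases le_or_gt (p ^ (t - 1)) (polytopeDim (convexHull ℝ {x ∈ S | f x = 0})) with hle | hlt
    · exact hmul _ (hfaceA hle hFI rfl) _ (normalizedVolume_mem_zmultiples_one _
        (hFJ.isLatticePolytope hSf' hS' (convexHull_nonempty_iff.2 hJ)) rfl)
    · rw [mul_comm]
      exact hmul _ (hfaceB (by omega) hFJ rfl) _ (normalizedVolume_mem_zmultiples_one _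
        (hFI.isLatticePolytope hSf hS (convexHull_nonempty_iff.2 hI)) rfl)
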